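/- Let \((M,\mathcal F)\) be a foliated manifold: \(M\) is a (Hausdorff, second countable) smooth manifold and \(\mathcal F\) is a foliation of codimension \(q\), given by a maximal family of submersions \(f_i:U_i\to\mathbb R^q\) whose domains form an open cover of \(M\) and which differ, near each common point, by a local diffeomorphism of \(\mathbb R^q\). Let a group \(H\) act on \(M\) by foliation automorphisms, i.e. each \(h\in H\) acts as a diffeomorphism of \(M\) preserving \(\mathcal F\). Equip the leaf space \(M/\mathcal F\) with the quotient diffeology of the manifold diffeology of \(M\), and let \(\pi:M\to M/\mathcal F\) be the quotient map. A differential \(k\)-form on a diffeological space \(X\) assigns to each plot \(\alpha:U\to X\) (with \(U\) open in some \(\mathbb R^m\)) a smooth \(k\)-form \(\gamma_\alpha\) on \(U\) such that \(\gamma_{\alpha\circ f}=f^*\gamma_\alpha\) for every smooth map \(f:V\to U\) between open subsets of Euclidean spaces. These forms make up the de Rham complex \(\Omega^\bullet(X)\), with \((d\gamma)_\alpha=d(\gamma_\alpha)\) and cohomology \(H^\bullet(X)\); a smooth map \(g\) acts by \((g^*\gamma)_\alpha=\gamma_{g\circ\alpha}\). Let \(\Omega^\bullet(M,\mathcal F)\)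 be the complex of basic forms, i.e. of the smooth forms \(\omega\) on \(M\) with \(\iota_X\omega=0\) and \(\mathcal L_X\omega=0\) for every smooth vector field \(X\) tangent to \(\mathcal F\), and let \(H^\bullet(M,\mathcal F)\) be its cohomology. Then: (i) the action of \(H\) descends to an action on \(M/\mathcal F\), that is \(h\cdot\pi(x)=\pi(h\cdot x)\) for all \(h\in H\), \(x\in M\), and every \(h\in H\) acts on \(M/\mathcal F\) as a diffeological diffeomorphism (a smooth bijection with smooth inverse); (ii) pullback along \(\pi\) is an isomorphism of cochain complexes \[\pi^*:\Omega^\bullet(M/\mathcal F)\xrightarrow{\ \cong\ }\Omega^\bullet(M,\mathcal F),\] where \(\pi^*\alpha\) is the form on \(M\) with \(p^*(\pi^*\alpha)=\alpha_{\pi\circ p}\) for every plot (i.e. smooth map) \(p:U\to M\); it is \(H\)-equivariant: \(\pi^*(h^*\alpha)=h^*(\pi^*\alpha)\) for all \(h\in H\) and all \(\alpha\); (iii) in every degree \(k\), the map induced by \(\pi^*\) is an \(H\)-equivariant isomorphism \(H^k(M/\mathcal F)\cong H^k(M,\mathcal F)\). -/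

import Mathlib

set_option linter.unusedSectionVars false

universe u

open scoped Manifold ContDiff

noncomputable section

namespace LeafDeRham

open Set Filter Topology

/-- Euclidean space `ℝᵐ`. -/
abbrev E (m : ℕ) : Type := EuclideanSpace ℝ (Fin m)

/-- Alternating `k`-linear forms on `ℝᵐ`. -/
abbrev Alt (m k : ℕ) : Type := E m [⋀^Fin k]→L[ℝ] ℝ

/-! ### Pullback and exterior derivative on Euclidean spaces -/

theorem contDiffAt_compCLM {a b c k : ℕ} {η : E a → Alt c k} {L : E a → E b →L[ℝ] E c} {x : E a}
    (hη : ContDiffAt ℝ ∞ η x) (hL : ContDiffAt ℝ ∞ L x) :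
    ContDiffAt ℝ ∞ (fun y => (η y).compContinuousLinearMap (L y)) x := by
  let V := ContinuousMultilinearMap ℝ (fun _ : Fin k => E b) ℝ
  let T : Alt b k →L[ℝ] V := ContinuousAlternatingMap.toContinuousMultilinearMapCLM ℝ
  let T' : Alt c k →L[ℝ] ContinuousMultilinearMap ℝ (fun _ : Fin k => E c) ℝ :=
    ContinuousAlternatingMap.toContinuousMultilinearMapCLM ℝ
  have hT : Function.Injective T := ContinuousAlternatingMap.toContinuousMultilinearMap_injective
  have : FiniteDimensional ℝ V :=
    FiniteDimensional.of_injective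
      (ContinuousMultilinearMap.toMultilinearMapLinear :
        V →ₗ[ℝ] MultilinearMap ℝ (fun _ : Fin k => E b) ℝ)
      ContinuousMultilinearMap.toMultilinearMap_injective
  obtain ⟨S, hS⟩ := (T : Alt b k →ₗ[ℝ] V).exists_leftInverse_of_injective
    (LinearMap.ker_eq_bot.2 hT)
  have hmain : ContDiffAt ℝ ∞ (fun y =>
      (ContinuousMultilinearMap.compContinuousLinearMapContinuousMultilinear ℝ
        (fun _ : Fin k => E b) (fun _ => E c) ℝ (fun _ => L y)) (T' (η y))) x := by
    refine ContDiffAt.clm_apply ?_ (T'.contDiff.contDiffAt.comp x hη)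
    exact (ContinuousMultilinearMap.contDiff _).contDiffAt.comp x (contDiffAt_pi.2 fun _ => hL)
  have h2 := (LinearMap.toContinuousLinearMap S).contDiff.contDiffAt.comp x hmain
  refine h2.congr_of_eventuallyEq (Eventually.of_forall fun y => ?_)
  exact (LinearMap.congr_fun hS ((η y).compContinuousLinearMap (L y))).symm

theorem contDiffOn_extDeriv {m k : ℕ} {η : E m → Alt m k} {u : Set (E m)} (hu : IsOpen u)
    (hη : ContDiffOn ℝ ∞ η u) : ContDiffOn ℝ ∞ (extDeriv η) u := by
  have h := hη.fderiv_of_isOpen (m := ∞) hu (by simp)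
  exact (ContinuousAlternatingMap.alternatizeUncurryFinCLM ℝ (E m) ℝ).contDiff.comp_contDiffOn h

theorem extDeriv_congr_on {m k : ℕ} {η θ : E m → Alt m k} {u : Set (E m)} (hu : IsOpen u)
    (h : ∀ y ∈ u, η y = θ y) : ∀ y ∈ u, extDeriv η y = extDeriv θ y := fun _ hy =>
  Filter.EventuallyEq.extDeriv_eq (Filter.eventuallyEq_of_mem (hu.mem_nhds hy) h)

theorem two_le_smooth : minSmoothness ℝ 2 ≤ (∞ : WithTop ℕ∞) := by
  simp only [minSmoothness_of_isRCLikeNormedField]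
  exact WithTop.coe_le_coe.2 (le_top : (2 : ℕ∞) ≤ ⊤)

/-! ### Diffeologies: plots on open sets, quotients, smooth bijections -/

open Diffeology

/-- A map `p` is a plot on the open set `u ⊆ ℝᵐ` if all its smooth reparametrizations by
Euclidean spaces are plots.  Only the values of `p` on `u` matter. -/
def IsPlotOn {X : Type*} [DiffeologicalSpace X] {m : ℕ} (u : Set (E m)) (p : E m → X) : Prop :=
  ∀ (l : ℕ) (f : E l → E m), ContDiff ℝ ∞ f → (∀ y, f y ∈ u) → IsPlot (p ∘ f)

theorem isPlotOn_univ {X : Type*} [DiffeologicalSpace X] {m : ℕ} {p : E m → X} :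
    IsPlotOn univ p ↔ IsPlot p :=
  ⟨fun h => h m id contDiff_id fun _ => mem_univ _, fun h _ _ hf _ => isPlot_reparam h hf⟩

theorem IsPlotOn.comp {X : Type*} [DiffeologicalSpace X] {l m : ℕ} {u : Set (E m)} {p : E m → X}
    (hp : IsPlotOn u p) {v : Set (E l)} {f : E l → E m} (hf : ContDiffOn ℝ ∞ f v)
    (hm : MapsTo f v u) : IsPlotOn v (p ∘ f) := fun _ g hg hgv =>
  hp _ (f ∘ g) (hf.comp_contDiff hg hgv) fun y => hm (hgv y)

theorem IsPlotOn.congr {X : Type*} [DiffeologicalSpace X] {m : ℕ} {u : Set (E m)} {p q : E m → X}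
    (hp : IsPlotOn u p) (h : ∀ y ∈ u, q y = p y) : IsPlotOn u q := fun l f hf hu => by
  have : q ∘ f = p ∘ f := funext fun y => h _ (hu y)
  rw [this]; exact hp l f hf hu

/-- Every point of an open set is the centre of a smoothly parametrized ball in it. -/
theorem exists_param {m : ℕ} {u : Set (E m)} (hu : IsOpen u) {x : E m} (hx : x ∈ u) :
    ∃ (f g : E m → E m) (v : Set (E m)), IsOpen v ∧ x ∈ v ∧ v ⊆ u ∧ ContDiff ℝ ∞ f ∧
      (∀ y, f y ∈ v) ∧ ContDiffOn ℝ ∞ g v ∧ ∀ y ∈ v, f (g y) = y := by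
  obtain ⟨ε, hε, hb⟩ := Metric.isOpen_iff.1 hu x hx
  refine ⟨OpenPartialHomeomorph.univBall x ε, (OpenPartialHomeomorph.univBall x ε).symm,
    Metric.ball x ε, Metric.isOpen_ball, Metric.mem_ball_self hε, hb,
    OpenPartialHomeomorph.contDiff_univBall, fun y => ?_,
    OpenPartialHomeomorph.contDiffOn_univBall_symm, fun y hy => ?_⟩
  · have := (OpenPartialHomeomorph.univBall x ε).map_source (x := y)
      (by rw [OpenPartialHomeomorph.univBall_source]; trivial)
    rwa [OpenPartialHomeomorph.univBall_target x hε] at this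
  · exact (OpenPartialHomeomorph.univBall x ε).right_inv
      (by rwa [OpenPartialHomeomorph.univBall_target x hε])

/-- The quotient diffeology: a map into the quotient is a plot iff it locally lifts to a plot. -/
@[reducible]
def quotientDiffeology {X : Type*} [DiffeologicalSpace X] (r : Setoid X) :
    DiffeologicalSpace (Quotient r) where
  plots m := {p | ∀ x : E m, ∃ u : Set (E m), IsOpen u ∧ x ∈ u ∧
    ∃ q : E m → X, IsPlotOn u q ∧ ∀ y ∈ u, p y = Quotient.mk r (q y)}
  constant_plots {m} x := fun _ => by
    obtain ⟨a, rfl⟩ := Quotient.exists_rep x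
    exact ⟨univ, isOpen_univ, mem_univ _, fun _ => a, isPlotOn_univ.2 isPlot_const,
      fun _ _ => rfl⟩
  plot_reparam {l m p f} hp hf := fun x => by
    obtain ⟨u, hu, hxu, q, hq, hpq⟩ := hp (f x)
    exact ⟨f ⁻¹' u, hu.preimage hf.continuous, hxu, q ∘ f,
      hq.comp hf.contDiffOn (mapsTo_preimage f u), fun y hy => hpq _ hy⟩
  locality {m p} hp := fun x => by
    obtain ⟨u, hu, hxu, h⟩ := hp x
    obtain ⟨f, g, v, hv, hxv, hvu, hf, hfv, hg, hfg⟩ := exists_param hu hxu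
    obtain ⟨w, hw, hxw, q, hq, hpq⟩ := h (fun y => hvu (hfv y)) hf (g x)
    refine ⟨v ∩ g ⁻¹' w, hg.continuousOn.isOpen_inter_preimage hv hw, ⟨hxv, hxw⟩, q ∘ g,
      hq.comp (hg.mono inter_subset_left) fun y hy => hy.2, fun y hy => ?_⟩
    have := hpq (g y) hy.2
    rwa [Function.comp_apply, hfg y hy.1] at this

/-- Diffeological diffeomorphisms. -/
def IsDDiffeo {X Y : Type*} [DiffeologicalSpace X] [DiffeologicalSpace Y] (f : X → Y) : Prop :=
  DSmooth f ∧ ∃ g : Y → X, Function.LeftInverse g f ∧ Function.RightInverse g f ∧ DSmooth g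

/-! ### Differential forms on diffeological spaces -/

/-- A plot of `X` defined on an open subset of `ℝᵐ`. -/
structure LocalPlot (X : Type*) [DiffeologicalSpace X] (m : ℕ) where
  dom : Set (E m)
  isOpen_dom : IsOpen dom
  map : E m → X
  isPlotOn : IsPlotOn dom map

/-- Composition of a plot with a smooth map of diffeological spaces. -/
def LocalPlot.post {X Y : Type*} [DiffeologicalSpace X] [DiffeologicalSpace Y] {m : ℕ}
    (P : LocalPlot X m) (f : X → Y) (hf : DSmooth f) : LocalPlot Y m where
  dom := P.dom
  isOpen_dom := P.isOpen_dom
  map := f ∘ P.map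
  isPlotOn := fun l g hg hu => hf l _ (P.isPlotOn l g hg hu)

/-- A differential `k`-form on a diffeological space: a smooth `k`-form on the domain of every
plot, compatible with smooth changes of parameters.  The form of a plot is normalized to be `0`
outside the domain of the plot.  (The compatibility, with `f` the identity, also says that the
form depends only on the values of the plot on its domain.) -/
def DForm (X : Type*) [DiffeologicalSpace X] (k : ℕ) :
    Submodule ℝ ((m : ℕ) → LocalPlot X m → E m → Alt m k) where
  carrier := {γ |
    (∀ m (P : LocalPlot X m), ContDiffOn ℝ ∞ (γ m P) P.dom) ∧
    (∀ m (P : LocalPlot X m), ∀ y ∉ P.dom, γ m P y = 0) ∧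
    ∀ (l m : ℕ) (P : LocalPlot X m) (Q : LocalPlot X l) (f : E l → E m),
      ContDiffOn ℝ ∞ f Q.dom → MapsTo f Q.dom P.dom → (∀ y ∈ Q.dom, Q.map y = P.map (f y)) →
      ∀ y ∈ Q.dom, γ l Q y = (γ m P (f y)).compContinuousLinearMap (fderiv ℝ f y)}
  add_mem' {γ δ} hγ hδ := ⟨fun m P => (hγ.1 m P).add (hδ.1 m P),
    fun m P y hy => by simp [hγ.2.1 m P y hy, hδ.2.1 m P y hy],
    fun l m P Q f hf hm he y hy => by
      simp only [Pi.add_apply]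
      rw [hγ.2.2 l m P Q f hf hm he y hy, hδ.2.2 l m P Q f hf hm he y hy]; rfl⟩
  zero_mem' := ⟨fun _ _ => contDiffOn_const, fun _ _ _ _ => rfl, fun _ _ _ _ _ _ _ _ _ _ => rfl⟩
  smul_mem' c γ hγ := ⟨fun m P => (hγ.1 m P).const_smul c,
    fun m P y hy => by simp [hγ.2.1 m P y hy],
    fun l m P Q f hf hm he y hy => by
      simp only [Pi.smul_apply]
      rw [hγ.2.2 l m P Q f hf hm he y hy]; rfl⟩

namespace DForm

variable {X Y : Type*} [DiffeologicalSpace X] [DiffeologicalSpace Y] {k : ℕ}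

theorem diffAt (γ : DForm X k) {m : ℕ} (P : LocalPlot X m) {y : E m} (hy : y ∈ P.dom) :
    DifferentiableAt ℝ (γ.1 m P) y :=
  ((γ.2.1 m P).contDiffAt (P.isOpen_dom.mem_nhds hy)).differentiableAt (by simp)

/-- The exterior derivative, taken plot by plot. -/
def d (k : ℕ) : DForm X k →ₗ[ℝ] DForm X (k + 1) where
  toFun γ := ⟨fun m P => P.dom.indicator (extDeriv (γ.1 m P)), by
    refine ⟨fun m P => ?_, fun m P y hy => indicator_of_notMem hy _, ?_⟩
    · exact (contDiffOn_extDeriv P.isOpen_dom (γ.2.1 m P)).congr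
        fun y hy => indicator_of_mem hy _
    · intro l m P Q f hf hm he y hy
      show Q.dom.indicator (extDeriv (γ.1 l Q)) y = ContinuousAlternatingMap.compContinuousLinearMap
        (P.dom.indicator (extDeriv (γ.1 m P)) (f y)) _
      rw [indicator_of_mem hy, indicator_of_mem (hm hy)]
      rw [extDeriv_congr_on Q.isOpen_dom (γ.2.2.2 l m P Q f hf hm he) y hy]
      exact extDeriv_pullback (diffAt γ P (hm hy))
        (hf.contDiffAt (Q.isOpen_dom.mem_nhds hy)) two_le_smooth⟩
  map_add' γ δ := by
    ext m P y : 4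
    by_cases hy : y ∈ P.dom
    · simp only [Submodule.coe_add, Pi.add_apply, indicator_of_mem hy]
      exact extDeriv_add (diffAt γ P hy) (diffAt δ P hy)
    · simp [indicator_of_notMem hy]
  map_smul' c γ := by
    ext m P y : 4
    by_cases hy : y ∈ P.dom
    · simp only [Submodule.coe_smul, Pi.smul_apply, indicator_of_mem hy, RingHom.id_apply]
      exact extDeriv_smul c _
    · simp [indicator_of_notMem hy]

theorem d_apply (γ : DForm X k) {m : ℕ} (P : LocalPlot X m) {y : E m} (hy : y ∈ P.dom) :
    (d k γ).1 m P y = extDeriv (γ.1 m P) y := indicator_of_mem hy _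

theorem ext_on {γ δ : DForm X k}
    (h : ∀ m (P : LocalPlot X m), ∀ y ∈ P.dom, γ.1 m P y = δ.1 m P y) : γ = δ := by
  apply Subtype.ext; funext m P y
  by_cases hy : y ∈ P.dom
  · exact h m P y hy
  · rw [γ.2.2.1 m P y hy, δ.2.2.1 m P y hy]

theorem d_d (γ : DForm X k) : d (k + 1) (d k γ) = 0 := by
  refine ext_on fun m P y hy => ?_
  rw [d_apply _ P hy, extDeriv_congr_on P.isOpen_dom (fun z hz => d_apply γ P hz) y hy]
  exact extDeriv_extDeriv_apply ((γ.2.1 m P).contDiffAt (P.isOpen_dom.mem_nhds hy)) two_le_smooth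

/-- Pullback of forms along a smooth map: the value on a plot `p` is the value on `f ∘ p`. -/
def pullback (f : X → Y) (hf : DSmooth f) (k : ℕ) : DForm Y k →ₗ[ℝ] DForm X k where
  toFun γ := ⟨fun m P => γ.1 m (P.post f hf), fun m P => γ.2.1 m (P.post f hf),
    fun m P => γ.2.2.1 m (P.post f hf), fun l m P Q g hg hm he =>
      γ.2.2.2 l m (P.post f hf) (Q.post f hf) g hg hm fun y hy => congrArg f (he y hy)⟩
  map_add' _ _ := rfl
  map_smul' _ _ := rfl

theorem d_pullback (f : X → Y) (hf : DSmooth f) (γ : DForm Y k) :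
    d k (pullback f hf k γ) = pullback f hf (k + 1) (d k γ) := rfl

end DForm

open CategoryTheory in
/-- The de Rham complex of a diffeological space. -/
def dComplex (X : Type u) [DiffeologicalSpace X] : CochainComplex (ModuleCat.{u} ℝ) ℕ :=
  CochainComplex.of (fun k => ModuleCat.of ℝ (DForm X k)) (fun k => ModuleCat.ofHom (DForm.d k))
    fun k => by ext γ : 2; exact DForm.d_d γ

open CategoryTheory in
/-- Pullback along a smooth map, as a map of de Rham complexes. -/
def dPullback {X Y : Type u} [DiffeologicalSpace X] [DiffeologicalSpace Y] (f : X → Y)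
    (hf : DSmooth f) : dComplex Y ⟶ dComplex X :=
  CochainComplex.ofHom (fun k => ModuleCat.ofHom (DForm.pullback f hf k)) fun k => by
    simp only [dComplex, CochainComplex.of_d]; rfl

/-! ### Differential forms on manifolds -/

section Manifold

variable {n : ℕ} {M : Type*} [TopologicalSpace M] [ChartedSpace (E n) M]

/-- Not necessarily smooth `k`-forms on the `n`-manifold `M`: the tangent space
`TangentSpace (𝓡 n) x` at every point `x` is by definition `ℝⁿ`, through the preferred chart. -/
abbrev RawForm (n : ℕ) (M : Type*) (k : ℕ) : Type _ := M → Alt n k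

/-- The differential of a map between manifolds. -/
def tmap (m n : ℕ) {M N : Type*} [TopologicalSpace M] [ChartedSpace (E n) M]
    [TopologicalSpace N] [ChartedSpace (E m) N] (g : N → M) (y : N) : E m →L[ℝ] E n :=
  mfderiv (𝓡 m) (𝓡 n) g y

/-- Pullback of a form on `M` along a map from a manifold to `M`. -/
def pull (m n : ℕ) {M N : Type*} [TopologicalSpace M] [ChartedSpace (E n) M]
    [TopologicalSpace N] [ChartedSpace (E m) N] {k : ℕ} (g : N → M)
    (η : RawForm n M k) : RawForm m N k :=
  fun y => (η (g y)).compContinuousLinearMap (tmap m n g y)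

/-- The form in the preferred chart at `c`. -/
def rep {k : ℕ} (η : RawForm n M k) (c : M) : E n → Alt n k :=
  pull n n (extChartAt (𝓡 n) c).symm η

/-- The exterior derivative, computed at every point in the preferred chart there. -/
def dRaw {k : ℕ} (η : RawForm n M k) : RawForm n M (k + 1) := fun x =>
  (extDeriv (rep η x) (extChartAt (𝓡 n) x x)).compContinuousLinearMap
    (tmap n n (extChartAt (𝓡 n) x) x)

/-- Smooth `k`-forms on `M`: those that are smooth in the charts. -/
def MForm (n : ℕ) (M : Type*) [TopologicalSpace M] [ChartedSpace (E n) M] (k : ℕ) :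
    Submodule ℝ (RawForm n M k) where
  carrier := {η | ∀ c : M, ContDiffOn ℝ ∞ (rep η c) (extChartAt (𝓡 n) c).target}
  add_mem' h h' := fun c => (h c).add (h' c)
  zero_mem' := fun _ => (contDiffOn_const (c := (0 : Alt n k))).congr fun _ _ => rfl
  smul_mem' a _ h := fun c => (h c).const_smul a

theorem MForm.smooth {k : ℕ} (η : MForm n M k) (c : M) :
    ContDiffOn ℝ ∞ (rep η.1 c) (extChartAt (𝓡 n) c).target := η.2 c

/-- Reparametrization by balls detects smoothness. -/
theorem contMDiffOn_of_reparam {m : ℕ} {u : Set (E m)} (hu : IsOpen u) {p : E m → M}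
    (h : ∀ f : E m → E m, ContDiff ℝ ∞ f → (∀ y, f y ∈ u) →
      ContMDiff (𝓡 m) (𝓡 n) ∞ (p ∘ f)) : ContMDiffOn (𝓡 m) (𝓡 n) ∞ p u := by
  intro x hx
  obtain ⟨f, g, v, hv, hxv, hvu, hf, hfv, hg, hfg⟩ := exists_param hu hx
  have h1 := (h f hf fun y => hvu (hfv y)).contMDiffAt.comp x
    (hg.contDiffAt (hv.mem_nhds hxv)).contMDiffAt
  refine (h1.congr_of_eventuallyEq ?_).contMDiffWithinAt
  filter_upwards [hv.mem_nhds hxv] with y hy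
  simp [hfg y hy]

/-- The manifold diffeology: the plots are the smooth maps. -/
@[reducible]
def manifoldDiffeology (n : ℕ) (M : Type*) [TopologicalSpace M] [ChartedSpace (E n) M] :
    DiffeologicalSpace M where
  plots m := {p | ContMDiff (𝓡 m) (𝓡 n) ∞ p}
  constant_plots _ := contMDiff_const
  plot_reparam hp hf := hp.comp hf.contMDiff
  locality {m p} hp := fun x => by
    obtain ⟨u, hu, hxu, h⟩ := hp x
    exact (contMDiffOn_of_reparam hu fun f hf hfu => h hfu hf).contMDiffAt (hu.mem_nhds hxu)

theorem isPlotOn_manifold_iff {m : ℕ} {u : Set (E m)} (hu : IsOpen u) {p : E m → M} :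
    @IsPlotOn M (manifoldDiffeology n M) m u p ↔ ContMDiffOn (𝓡 m) (𝓡 n) ∞ p u :=
  ⟨fun h => contMDiffOn_of_reparam hu fun f hf hfu => h m f hf hfu,
    fun h _ _ hf hfu => h.comp_contMDiff hf.contMDiff hfu⟩

variable [IsManifold (𝓡 n) ∞ M]

theorem tmap_comp {l m : ℕ} {N : Type*} [TopologicalSpace N] [ChartedSpace (E m) N]
    {O : Type*} [TopologicalSpace O] [ChartedSpace (E l) O] {g : N → M} {f : O → N} {y : O}
    (hg : MDifferentiableAt (𝓡 m) (𝓡 n) g (f y)) (hf : MDifferentiableAt (𝓡 l) (𝓡 m) f y) :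
    tmap l n (g ∘ f) y = (tmap m n g (f y)).comp (tmap l m f y) := mfderiv_comp y hg hf

theorem tmap_eucl {l m : ℕ} (f : E l → E m) (y : E l) : tmap l m f y = fderiv ℝ f y :=
  mfderiv_eq_fderiv

theorem pull_comp {l m : ℕ} {N : Type*} [TopologicalSpace N] [ChartedSpace (E m) N]
    {O : Type*} [TopologicalSpace O] [ChartedSpace (E l) O]
    {k : ℕ} {g : N → M} {f : O → N} {η : RawForm n M k} {y : O}
    (hg : MDifferentiableAt (𝓡 m) (𝓡 n) g (f y)) (hf : MDifferentiableAt (𝓡 l) (𝓡 m) f y) :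
    pull l n (g ∘ f) η y = pull l m f (pull m n g η) y := by
  simp only [pull, tmap_comp hg hf]; rfl

theorem pull_congr {m : ℕ} {N : Type*} [TopologicalSpace N] [ChartedSpace (E m) N]
    {k : ℕ} {g g' : N → M} {η : RawForm n M k} {y : N} (h : g =ᶠ[𝓝 y] g') :
    pull m n g η y = pull m n g' η y := by
  have h1 : tmap m n g y = tmap m n g' y := h.mfderiv_eq
  simp only [pull, h1, h.eq_of_nhds]

theorem pull_eucl {l m k : ℕ} {f : E l → E m} {η : E m → Alt m k} (y : E l) :
    pull l m f η y = (η (f y)).compContinuousLinearMap (fderiv ℝ f y) := by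
  simp only [pull, tmap_eucl]

theorem chart_symm_smooth (c : M) {z : E n} (hz : z ∈ (extChartAt (𝓡 n) c).target) :
    ContMDiffAt (𝓡 n) (𝓡 n) ∞ (extChartAt (𝓡 n) c).symm z :=
  (contMDiffOn_extChartAt_symm c).contMDiffAt ((isOpen_extChartAt_target c).mem_nhds hz)

theorem chart_smooth (c : M) {z : M} (hz : z ∈ (extChartAt (𝓡 n) c).source) :
    ContMDiffAt (𝓡 n) (𝓡 n) ∞ (extChartAt (𝓡 n) c) z :=
  contMDiffAt_extChartAt' (by rwa [extChartAt_source] at hz)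

/-- Pullback along a map from a Euclidean space, computed in a chart of `M`. -/
theorem pull_eq_rep {m k : ℕ} {g : E m → M} (η : RawForm n M k) (c : M) {y : E m}
    (hg : ContMDiffAt (𝓡 m) (𝓡 n) ∞ g y) (hc : g y ∈ (extChartAt (𝓡 n) c).source) :
    pull m n g η =ᶠ[𝓝 y] fun z => (rep η c (extChartAt (𝓡 n) c (g z))).compContinuousLinearMap
      (fderiv ℝ (extChartAt (𝓡 n) c ∘ g) z) := by
  have h1 : ∀ᶠ z in 𝓝 y, g z ∈ (extChartAt (𝓡 n) c).source :=
    hg.continuousAt.eventually_mem ((isOpen_extChartAt_source c).mem_nhds hc)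
  have h2 : ∀ᶠ z in 𝓝 y, MDifferentiableAt (𝓡 m) (𝓡 n) g z := by
    have : IsManifold (𝓡 n) 1 M := IsManifold.of_le (n := ∞) (by simp)
    filter_upwards [(contMDiffAt_iff_contMDiffAt_nhds (by simp)).1
      (hg.of_le (m := 1) (by simp))] with z hz
    exact hz.mdifferentiableAt (by simp)
  filter_upwards [h1.eventually_nhds, h2] with z hz hgz
  have hz' := hz.self_of_nhds
  have e : g =ᶠ[𝓝 z] (extChartAt (𝓡 n) c).symm ∘ (extChartAt (𝓡 n) c ∘ g) := by
    filter_upwards [hz] with t ht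
    exact ((extChartAt (𝓡 n) c).left_inv ht).symm
  have hφ := ((chart_smooth c hz').mdifferentiableAt (by simp)).comp z hgz
  rw [pull_congr e, pull_comp (m := n), pull_eucl]
  · rfl
  · exact (chart_symm_smooth c ((extChartAt (𝓡 n) c).map_source hz')).mdifferentiableAt (by simp)
  · exact hφ

theorem rep_smooth {k : ℕ} (η : MForm n M k) (c : M) {z : E n}
    (hz : z ∈ (extChartAt (𝓡 n) c).target) : ContDiffAt ℝ ∞ (rep η.1 c) z :=
  (MForm.smooth η c).contDiffAt ((isOpen_extChartAt_target c).mem_nhds hz)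

theorem pull_smooth {m k : ℕ} {g : E m → M} (η : MForm n M k) {y : E m}
    (hg : ContMDiffAt (𝓡 m) (𝓡 n) ∞ g y) : ContDiffAt ℝ ∞ (pull m n g η.1) y := by
  have hs : g y ∈ (extChartAt (𝓡 n) (g y)).source := mem_extChartAt_source (g y)
  have hφ : ContDiffAt ℝ ∞ (extChartAt (𝓡 n) (g y) ∘ g) y :=
    ((chart_smooth (g y) hs).comp y hg).contDiffAt
  refine ContDiffAt.congr_of_eventuallyEq ?_ (pull_eq_rep η.1 (g y) hg hs)
  refine contDiffAt_compCLM ?_ ?_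
  · exact (rep_smooth η (g y) ((extChartAt (𝓡 n) (g y)).map_source hs)).comp y hφ
  · exact hφ.fderiv_right (m := ∞) (by simp)

/-- The exterior derivative commutes with pullbacks to Euclidean spaces. -/
theorem pull_dRaw {m k : ℕ} {g : E m → M} (η : MForm n M k) {y : E m}
    (hg : ContMDiffAt (𝓡 m) (𝓡 n) ∞ g y) :
    pull m n g (dRaw η.1) y = extDeriv (pull m n g η.1) y := by
  have hs : g y ∈ (extChartAt (𝓡 n) (g y)).source := mem_extChartAt_source (g y)
  have hφ : ContDiffAt ℝ ∞ (extChartAt (𝓡 n) (g y) ∘ g) y :=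
    ((chart_smooth (g y) hs).comp y hg).contDiffAt
  rw [Filter.EventuallyEq.extDeriv_eq (pull_eq_rep η.1 (g y) hg hs)]
  have hr := (rep_smooth η (g y) ((extChartAt (𝓡 n) (g y)).map_source hs)).differentiableAt
    (by simp)
  refine Eq.trans ?_ (extDeriv_pullback 
    (f := extChartAt (𝓡 n) (g y) ∘ g) hr hφ two_le_smooth).symm
  have ht : fderiv ℝ (extChartAt (𝓡 n) (g y) ∘ g) y =
      (tmap n n (extChartAt (𝓡 n) (g y)) (g y)).comp (tmap m n g y) := by
    rw [← tmap_eucl]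
    exact tmap_comp ((chart_smooth (g y) hs).mdifferentiableAt (by simp))
      (hg.mdifferentiableAt (by simp))
  simp only [pull, dRaw, Function.comp_apply, ht]; rfl

theorem ext_rep {k : ℕ} {η θ : RawForm n M k}
    (h : ∀ c : M, ∀ z ∈ (extChartAt (𝓡 n) c).target, rep η c z = rep θ c z) : η = θ := by
  have key : ∀ (ζ : RawForm n M k) (x : M), ζ x =
      (rep ζ x (extChartAt (𝓡 n) x x)).compContinuousLinearMap
      (tmap n n (extChartAt (𝓡 n) x) x) := by
    intro ζ x
    have hs := mem_extChartAt_source (I := 𝓡 n) x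
    have e : (extChartAt (𝓡 n) x).symm ∘ extChartAt (𝓡 n) x =ᶠ[𝓝 x] id := by
      filter_upwards [(isOpen_extChartAt_source (I := 𝓡 n) x).mem_nhds hs] with t ht
      exact (extChartAt (𝓡 n) x).left_inv ht
    have h1 : pull n n ((extChartAt (𝓡 n) x).symm ∘ extChartAt (𝓡 n) x) ζ x = ζ x := by
      rw [pull_congr e]; 
      have h2 : tmap n n (id : M → M) x = ContinuousLinearMap.id ℝ (E n) := mfderiv_id
      simp only [pull, h2]; rfl
    rw [← h1, pull_comp (m := n)]
    · rfl
    · exact (chart_symm_smooth x ((extChartAt (𝓡 n) x).map_source hs)).mdifferentiableAt (by simp)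
    · exact (chart_smooth x hs).mdifferentiableAt (by simp)
  funext x
  rw [key η, key θ, h x _ (mem_extChartAt_target x)]

theorem rep_dRaw {k : ℕ} (η : MForm n M k) (c : M) {z : E n}
    (hz : z ∈ (extChartAt (𝓡 n) c).target) : rep (dRaw η.1) c z = extDeriv (rep η.1 c) z :=
  pull_dRaw η (chart_symm_smooth c hz)

/-- Pullback of a form along a smooth map between manifolds. -/
def MForm.pullback (g : M → M) (hg : ContMDiff (𝓡 n) (𝓡 n) ∞ g) (k : ℕ) :
    MForm n M k →ₗ[ℝ] MForm n M k where
  toFun η := ⟨pull n n g η.1, by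
    intro c
    have h : ∀ z ∈ (extChartAt (𝓡 n) c).target,
        rep (pull n n g η.1) c z = pull n n (g ∘ (extChartAt (𝓡 n) c).symm) η.1 z := fun z hz =>
      (pull_comp (hg.mdifferentiableAt (by simp))
        ((chart_symm_smooth c hz).mdifferentiableAt (by simp))).symm
    refine ContDiffOn.congr (fun z hz => ?_) h
    exact (pull_smooth η (hg.contMDiffAt.comp z (chart_symm_smooth c hz))).contDiffWithinAt⟩
  map_add' _ _ := rfl
  map_smul' _ _ := rfl

/-- The exterior derivative of smooth forms. -/
def MForm.d (k : ℕ) : MForm n M k →ₗ[ℝ] MForm n M (k + 1) where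
  toFun η := ⟨dRaw η.1, fun c =>
    (contDiffOn_extDeriv (isOpen_extChartAt_target c) (MForm.smooth η c)).congr fun _ hz => rep_dRaw η c hz⟩
  map_add' η θ := by
    apply Subtype.ext; funext x
    have hx := mem_extChartAt_target (I := 𝓡 n) x
    have h : extDeriv (rep (η.1 + θ.1) x) (extChartAt (𝓡 n) x x) =
        extDeriv (rep η.1 x) (extChartAt (𝓡 n) x x) + extDeriv (rep θ.1 x) (extChartAt (𝓡 n) x x) :=
      extDeriv_add ((rep_smooth η x hx).differentiableAt (by simp))
        ((rep_smooth θ x hx).differentiableAt (by simp))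
    simp only [dRaw, Submodule.coe_add, Pi.add_apply, h]; rfl
  map_smul' a η := by
    apply Subtype.ext; funext x
    have h : extDeriv (rep (a • η.1) x) (extChartAt (𝓡 n) x x) =
        a • extDeriv (rep η.1 x) (extChartAt (𝓡 n) x x) := extDeriv_smul a (rep η.1 x)
    simp only [dRaw, Submodule.coe_smul, Pi.smul_apply, h]; rfl

theorem MForm.d_d {k : ℕ} (η : MForm n M k) : MForm.d (k + 1) (MForm.d k η) = 0 := by
  apply Subtype.ext
  refine ext_rep fun c z hz => ?_
  have h1 := rep_dRaw (MForm.d k η) c hz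
  refine h1.trans ?_
  refine (extDeriv_congr_on (isOpen_extChartAt_target c) (fun t ht => rep_dRaw η c ht) z hz).trans ?_
  rw [extDeriv_extDeriv_apply (rep_smooth η c hz) two_le_smooth]; rfl

theorem MForm.d_pullback (g : M → M) (hg : ContMDiff (𝓡 n) (𝓡 n) ∞ g) {k : ℕ} (η : MForm n M k) :
    MForm.d k (MForm.pullback g hg k η) = MForm.pullback g hg (k + 1) (MForm.d k η) := by
  apply Subtype.ext
  refine ext_rep fun c z hz => ?_
  have hgc : ∀ t ∈ (extChartAt (𝓡 n) c).target,
      ContMDiffAt (𝓡 n) (𝓡 n) ∞ (g ∘ (extChartAt (𝓡 n) c).symm) t := fun t ht =>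
    hg.contMDiffAt.comp t (chart_symm_smooth c ht)
  have h : ∀ {k : ℕ} (θ : RawForm n M k), ∀ t ∈ (extChartAt (𝓡 n) c).target,
      rep (pull n n g θ) c t = pull n n (g ∘ (extChartAt (𝓡 n) c).symm) θ t := fun θ t ht =>
    (pull_comp (hg.mdifferentiableAt (by simp))
      ((chart_symm_smooth c ht).mdifferentiableAt (by simp))).symm
  refine (rep_dRaw (MForm.pullback g hg k η) c hz).trans ?_
  refine (extDeriv_congr_on (isOpen_extChartAt_target c) (h η.1) z hz).trans ?_
  exact (pull_dRaw η (hgc z hz)).symm.trans (h (dRaw η.1) z hz).symm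

/-- Diffeological forms for the manifold diffeology. -/
abbrev ManifoldDForm (n : ℕ) (M : Type*) [TopologicalSpace M] [ChartedSpace (E n) M] (k : ℕ) :=
  @DForm M (manifoldDiffeology n M) k

/-- A form on a manifold as a diffeological form: its value on a plot `p` is `p^* η`. -/
def MForm.toDForm (k : ℕ) : MForm n M k →ₗ[ℝ] ManifoldDForm n M k :=
  letI := manifoldDiffeology n M
  { toFun := fun η => ⟨fun m P => P.dom.indicator (pull m n P.map η.1), by
      have hP : ∀ {m : ℕ} (P : LocalPlot M m), ∀ y ∈ P.dom,
          ContMDiffAt (𝓡 m) (𝓡 n) ∞ P.map y := fun P y hy =>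
        ((isPlotOn_manifold_iff P.isOpen_dom).1 P.isPlotOn).contMDiffAt (P.isOpen_dom.mem_nhds hy)
      refine ⟨fun m P => ?_, fun m P y hy => indicator_of_notMem hy _, ?_⟩
      · refine ContDiffOn.congr (fun y hy => ?_) fun y hy => indicator_of_mem hy _
        exact (pull_smooth η (hP P y hy)).contDiffWithinAt
      · intro l m P Q f hf hm he y hy
        show Q.dom.indicator (pull l n Q.map η.1) y =
          ContinuousAlternatingMap.compContinuousLinearMap
            (P.dom.indicator (pull m n P.map η.1) (f y)) _
        rw [indicator_of_mem hy, indicator_of_mem (hm hy)]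
        have e : Q.map =ᶠ[𝓝 y] P.map ∘ f := Filter.eventuallyEq_of_mem (Q.isOpen_dom.mem_nhds hy) he
        have hfy := (hf.contDiffAt (Q.isOpen_dom.mem_nhds hy)).differentiableAt (by simp)
        rw [pull_congr e, pull_comp (m := m) ((hP P _ (hm hy)).mdifferentiableAt (by simp))
          hfy.mdifferentiableAt, pull_eucl]⟩
    map_add' := fun η θ => Subtype.ext <| by
      funext m P; exact indicator_add P.dom (pull m n P.map η.1) (pull m n P.map θ.1)
    map_smul' := fun a η => Subtype.ext <| by
      funext m P; exact indicator_const_smul P.dom a (pull m n P.map η.1) }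

/-! ### Contraction and Lie derivative -/

/-- Contraction of a form of positive degree with a vector field:
`(ι_X η)(v₁, …, v_k) = η(X, v₁, …, v_k)`. -/
def contr (X : M → E n) {k : ℕ} (η : RawForm n M (k + 1)) : RawForm n M k :=
  fun x => (η x).curryLeft (X x)

/-- Contraction `ι_X η` in all degrees; it is `0` on `0`-forms. -/
def contraction (X : M → E n) : {k : ℕ} → RawForm n M k → RawForm n M (k - 1)
  | 0, _ => 0
  | _ + 1, η => contr X η

/-- The Lie derivative of a form, given by Cartan's formula `L_X η = d ι_X η + ι_X d η`; the first
term vanishes on `0`-forms. -/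
def lieDeriv (X : M → E n) : {k : ℕ} → RawForm n M k → RawForm n M k
  | 0, η => contr X (dRaw η)
  | _ + 1, η => dRaw (contr X η) + contr X (dRaw η)

/-- Smooth vector fields. -/
def IsSmoothField (X : M → E n) : Prop :=
  ContMDiff (𝓡 n) (𝓡 n).tangent ∞ fun x => (⟨x, X x⟩ : TangentBundle (𝓡 n) M)

end Manifold

/-! ### Foliations -/

/-- A submersion from an open subset of the `n`-manifold `M` to `ℝ^q`.  Only the values of `map`
on `dom` matter. -/
structure LocalSubmersion (n q : ℕ) (M : Type*) [TopologicalSpace M] [ChartedSpace (E n) M] where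
  dom : Set M
  isOpen_dom : IsOpen dom
  map : M → E q
  smooth : ContMDiffOn (𝓡 n) (𝓡 q) ∞ map dom
  submersion : ∀ x ∈ dom, Function.Surjective (tmap n q map x)

/-- Two local submersions differ, near every common point, by a local diffeomorphism of `ℝ^q`.
The germ of this diffeomorphism is unique, since submersions are open maps; hence such germs
satisfy the cocycle condition. -/
def LocalSubmersion.Compatible {n q : ℕ} {M : Type*} [TopologicalSpace M] [ChartedSpace (E n) M]
    (s t : LocalSubmersion n q M) : Prop :=
  ∀ x ∈ s.dom ∩ t.dom, ∃ φ : OpenPartialHomeomorph (E q) (E q), s.map x ∈ φ.source ∧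
    ContDiffOn ℝ ∞ φ φ.source ∧ ContDiffOn ℝ ∞ φ.symm φ.target ∧ t.map =ᶠ[𝓝 x] φ ∘ s.map

/-- A codimension `q` foliation of the `n`-manifold `M`: a maximal family of compatible local
submersions to `ℝ^q` whose domains cover `M`. -/
structure Foliation (n q : ℕ) (M : Type*) [TopologicalSpace M] [ChartedSpace (E n) M] where
  family : Set (LocalSubmersion n q M)
  cover : ∀ x : M, ∃ s ∈ family, x ∈ s.dom
  compatible : ∀ s ∈ family, ∀ t ∈ family, s.Compatible t
  maximal : ∀ s : LocalSubmersion n q M, (∀ t ∈ family, s.Compatible t) → s ∈ family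

namespace Foliation

variable {n q : ℕ} {M : Type u} [TopologicalSpace M] [ChartedSpace (E n) M] (F : Foliation n q M)

/-- Two points lie in a common plaque: in a connected subset of a fibre of a submersion of `F`. -/
def SamePlaque (x y : M) : Prop :=
  ∃ s ∈ F.family, ∃ C ⊆ s.dom, IsPreconnected C ∧ x ∈ C ∧ y ∈ C ∧ ∀ z ∈ C, s.map z = s.map x

/-- The leaves are the classes of the equivalence relation of being joined by a finite chain of
plaques. -/
def leafSetoid : Setoid M := Relation.EqvGen.setoid F.SamePlaque

/-- The leaf space `M / F`. -/
def LeafSpace : Type _ := Quotient F.leafSetoid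

/-- The projection to the leaf space. -/
def proj (x : M) : F.LeafSpace := Quotient.mk F.leafSetoid x

/-- The leaf space carries the quotient diffeology of the manifold diffeology. -/
instance : DiffeologicalSpace F.LeafSpace :=
  @quotientDiffeology M (manifoldDiffeology n M) F.leafSetoid

theorem dsmooth_proj : @DSmooth M F.LeafSpace (manifoldDiffeology n M) _ F.proj := fun _ p hp _ =>
  ⟨univ, isOpen_univ, mem_univ _, p, (@isPlotOn_univ M (manifoldDiffeology n M) _ p).2 hp,
    fun _ _ => rfl⟩

/-- A vector field is tangent to `F` if it is tangent to the fibres of the submersions. -/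
def IsTangent (X : M → E n) : Prop :=
  ∀ s ∈ F.family, ∀ x ∈ s.dom, tmap n q s.map x (X x) = 0

/-- Foliation automorphisms: diffeomorphisms that preserve the defining family. -/
structure IsAutomorphism (g : M → M) : Prop where
  diffeo : ∃ Ψ : M ≃ₘ^∞⟮𝓡 n, 𝓡 n⟯ M, ⇑Ψ = g
  preserves : ∀ s ∈ F.family, ∃ t ∈ F.family, t.dom = g ⁻¹' s.dom ∧
    ∀ x ∈ t.dom, t.map x = s.map (g x)

theorem IsAutomorphism.contMDiff {F : Foliation n q M} {g : M → M} (h : F.IsAutomorphism g) :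
    ContMDiff (𝓡 n) (𝓡 n) ∞ g := by
  obtain ⟨Ψ, rfl⟩ := h.diffeo
  exact Ψ.contMDiff

variable [IsManifold (𝓡 n) ∞ M]

/-- A form is basic if `ι_X η = 0` and `L_X η = 0` for all smooth vector fields `X` tangent to
`F`. -/
def IsBasic {k : ℕ} (η : RawForm n M k) : Prop :=
  ∀ X : M → E n, IsSmoothField X → F.IsTangent X → contraction X η = 0 ∧ lieDeriv X η = 0

theorem dRaw_zero {k : ℕ} : dRaw (0 : RawForm n M k) = 0 :=
  congrArg Subtype.val (map_zero (MForm.d (n := n) (M := M) k))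

theorem dRaw_add {k : ℕ} {η θ : RawForm n M k} (hη : η ∈ MForm n M k) (hθ : θ ∈ MForm n M k) :
    dRaw (η + θ) = dRaw η + dRaw θ := by
  have h := (MForm.d (n := n) (M := M) k).map_add ⟨η, hη⟩ ⟨θ, hθ⟩
  exact Subtype.ext_iff.1 h

theorem dRaw_smul {k : ℕ} (a : ℝ) {η : RawForm n M k} (hη : η ∈ MForm n M k) :
    dRaw (a • η) = a • dRaw η := by
  have h := (MForm.d (n := n) (M := M) k).map_smul a ⟨η, hη⟩
  exact Subtype.ext_iff.1 h

theorem contr_add (X : M → E n) {k : ℕ} (η θ : RawForm n M (k + 1)) :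
    contr X (η + θ) = contr X η + contr X θ := rfl

theorem contr_smul (X : M → E n) {k : ℕ} (a : ℝ) (η : RawForm n M (k + 1)) :
    contr X (a • η) = a • contr X η := rfl

theorem contr_zero (X : M → E n) {k : ℕ} : contr X (0 : RawForm n M (k + 1)) = 0 := rfl

theorem contraction_add (X : M → E n) {k : ℕ} (η θ : RawForm n M k) :
    contraction X (η + θ) = contraction X η + contraction X θ := by
  cases k with
  | zero => exact (add_zero _).symm
  | succ k => rfl

theorem contraction_smul (X : M → E n) {k : ℕ} (a : ℝ) (η : RawForm n M k) :
    contraction X (a • η) = a • contraction X η := by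
  cases k with
  | zero => exact (smul_zero _).symm
  | succ k => rfl

theorem contraction_zero (X : M → E n) {k : ℕ} : contraction X (0 : RawForm n M k) = 0 := by
  cases k <;> rfl

theorem basic_iff (X : M → E n) {k : ℕ} (η : RawForm n M k) :
    contraction X η = 0 ∧ lieDeriv X η = 0 ↔ contraction X η = 0 ∧ contr X (dRaw η) = 0 := by
  refine and_congr_right fun h => ?_
  cases k with
  | zero => exact Iff.rfl
  | succ k =>
    have h0 : dRaw (contr X η) = 0 := (congrArg dRaw h).trans dRaw_zero
    simp only [lieDeriv, h0, zero_add]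

theorem isBasic_iff {k : ℕ} (η : RawForm n M k) : F.IsBasic η ↔
    ∀ X : M → E n, IsSmoothField X → F.IsTangent X →
      contraction X η = 0 ∧ contr X (dRaw η) = 0 := by
  simp only [IsBasic, basic_iff]

/-- Basic `k`-forms. -/
def BasicForm (k : ℕ) : Submodule ℝ (RawForm n M k) where
  carrier := {η | η ∈ MForm n M k ∧ F.IsBasic η}
  add_mem' {η θ} hη hθ := by
    rw [mem_ofPred_eq, isBasic_iff] at *
    refine ⟨add_mem hη.1 hθ.1, fun X hX hT => ?_⟩
    rw [dRaw_add hη.1 hθ.1, contraction_add, contr_add, (hη.2 X hX hT).1, (hη.2 X hX hT).2, (hθ.2 X hX hT).1,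
      (hθ.2 X hX hT).2]
    simp
  zero_mem' := by
    rw [mem_ofPred_eq, isBasic_iff]
    refine ⟨zero_mem _, fun X _ _ => ?_⟩
    rw [dRaw_zero, contraction_zero, contr_zero]
    simp
  smul_mem' a η hη := by
    rw [mem_ofPred_eq, isBasic_iff] at *
    refine ⟨Submodule.smul_mem _ a hη.1, fun X hX hT => ?_⟩
    rw [dRaw_smul a hη.1, contraction_smul, contr_smul, (hη.2 X hX hT).1, (hη.2 X hX hT).2]
    simp

/-- Basic forms as smooth forms. -/
def basicToMForm (k : ℕ) : F.BasicForm k →ₗ[ℝ] MForm n M k :=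
  Submodule.inclusion fun _ h => h.1

/-- The exterior derivative of basic forms. -/
def basicD (k : ℕ) : F.BasicForm k →ₗ[ℝ] F.BasicForm (k + 1) :=
  LinearMap.codRestrict _ ((MForm n M (k + 1)).subtype ∘ₗ MForm.d k ∘ₗ F.basicToMForm k)
    fun η => by
      have hη' := (F.isBasic_iff η.1).1 η.2.2
      refine ⟨(MForm.d k (F.basicToMForm k η)).2,
        (F.isBasic_iff _).2 fun X hX hT => ⟨(hη' X hX hT).2, ?_⟩⟩
      have e : dRaw (MForm.d k (F.basicToMForm k η)).1 = 0 :=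
        congrArg Subtype.val (MForm.d_d (F.basicToMForm k η))
      exact (congrArg (contr X) e).trans (contr_zero X)

theorem basicD_basicD {k : ℕ} (η : F.BasicForm k) : F.basicD (k + 1) (F.basicD k η) = 0 := by
  have h := MForm.d_d (F.basicToMForm k η)
  have h2 := congrArg Subtype.val h
  exact Subtype.ext h2

open CategoryTheory in
/-- The complex of basic forms. -/
def basicComplex : CochainComplex (ModuleCat.{u} ℝ) ℕ :=
  CochainComplex.of (fun k => ModuleCat.of ℝ (F.BasicForm k))
    (fun k => ModuleCat.ofHom (F.basicD k))
    fun k => by ext η : 2; exact F.basicD_basicD η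

/-- Tangent vector fields can be pushed forward along a foliation automorphism. -/
theorem exists_pushforward {g : M → M} (hg : F.IsAutomorphism g) {X : M → E n}
    (hX : IsSmoothField X) (hT : F.IsTangent X) : ∃ Y : M → E n, IsSmoothField Y ∧ F.IsTangent Y ∧
      ∀ x, Y (g x) = tmap n n g x (X x) := by
  obtain ⟨Ψ, hΨ⟩ := hg.diffeo
  have hgs := hg.contMDiff
  have hl : ∀ x, Ψ.symm (g x) = x := fun x => by rw [← hΨ]; exact Ψ.symm_apply_apply x
  have hr : ∀ x, g (Ψ.symm x) = x := fun x => by rw [← hΨ]; exact Ψ.apply_symm_apply x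
  refine ⟨fun x => tmap n n g (Ψ.symm x) (X (Ψ.symm x)), ?_, ?_, fun x => ?_⟩
  · have h := (hgs.contMDiff_tangentMap (m := ∞) (by simp)).comp (hX.comp Ψ.symm.contMDiff)
    refine h.congr fun x => ?_
    have key : ∀ (a : M) (v : E n), a = x → (⟨x, v⟩ : TangentBundle (𝓡 n) M) = ⟨a, v⟩ := by
      rintro a v rfl; rfl
    exact key (g (Ψ.symm x)) _ (hr x)
  rotate_right
  · show tmap n n g (Ψ.symm (g x)) (X (Ψ.symm (g x))) = _
    rw [hl]
  · intro s hs x hx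
    obtain ⟨t, ht, hdom, hmap⟩ := hg.preserves s hs
    have hx' : Ψ.symm x ∈ t.dom := by rw [hdom]; show g (Ψ.symm x) ∈ s.dom; rwa [hr]
    have h0 := hT t ht _ hx'
    have e : t.map =ᶠ[𝓝 (Ψ.symm x)] s.map ∘ g :=
      Filter.eventuallyEq_of_mem (t.isOpen_dom.mem_nhds hx') hmap
    have e1 : tmap n q t.map (Ψ.symm x) = tmap n q (s.map ∘ g) (Ψ.symm x) := e.mfderiv_eq
    rw [e1, tmap_comp (m := n) _ (hgs.mdifferentiableAt (by simp)), hr] at h0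
    · exact h0
    · rw [hr]
      exact (s.smooth.contMDiffAt (s.isOpen_dom.mem_nhds hx)).mdifferentiableAt (by simp)

theorem contr_pull {g : M → M} {X Y : M → E n} (h : ∀ x, Y (g x) = tmap n n g x (X x)) {k : ℕ}
    (η : RawForm n M (k + 1)) : contr X (pull n n g η) = pull n n g (contr Y η) := by
  funext x
  simp only [contr, pull, h]
  exact ContinuousAlternatingMap.curryLeft_compContinuousLinearMap _ _ _

theorem contraction_pull {g : M → M} {X Y : M → E n} (h : ∀ x, Y (g x) = tmap n n g x (X x)) {k : ℕ}
    (η : RawForm n M k) : contraction X (pull n n g η) = pull n n g (contraction Y η) := by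
  cases k with
  | zero => rfl
  | succ k =>
    exact contr_pull h η

/-- Pullback of basic forms along a foliation automorphism. -/
def basicPull {g : M → M} (hg : F.IsAutomorphism g) (k : ℕ) :
    F.BasicForm k →ₗ[ℝ] F.BasicForm k :=
  LinearMap.codRestrict _
    ((MForm n M k).subtype ∘ₗ MForm.pullback g hg.contMDiff k ∘ₗ F.basicToMForm k)
    fun η => by
      have hη' := (F.isBasic_iff η.1).1 η.2.2
      refine ⟨(MForm.pullback g hg.contMDiff k (F.basicToMForm k η)).2,
        (F.isBasic_iff _).2 fun X hX hT => ?_⟩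
      obtain ⟨Y, hY, hYT, h⟩ := F.exists_pushforward hg hX hT
      have e : dRaw (pull n n g η.1) = pull n n g (dRaw η.1) :=
        congrArg Subtype.val (MForm.d_pullback g hg.contMDiff (F.basicToMForm k η))
      show contraction X (pull n n g η.1) = 0 ∧ contr X (dRaw (pull n n g η.1)) = 0
      rw [e, contraction_pull h, contr_pull h, (hη' Y hY hYT).1, (hη' Y hY hYT).2]
      exact ⟨rfl, rfl⟩

theorem basicD_basicPull {g : M → M} (hg : F.IsAutomorphism g) {k : ℕ} (η : F.BasicForm k) :
    F.basicD k (F.basicPull hg k η) = F.basicPull hg (k + 1) (F.basicD k η) := by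
  have h := MForm.d_pullback g hg.contMDiff (F.basicToMForm k η)
  have h2 := congrArg Subtype.val h
  exact Subtype.ext h2

open CategoryTheory in
/-- Pullback along a foliation automorphism, as a map of complexes of basic forms. -/
def basicPullback {g : M → M} (hg : F.IsAutomorphism g) : F.basicComplex ⟶ F.basicComplex :=
  CochainComplex.ofHom (fun k => ModuleCat.ofHom (F.basicPull hg k)) fun k => by
    simp only [basicComplex, CochainComplex.of_d]
    ext η : 2
    exact F.basicD_basicPull hg η

/-- The pullback `π^*` of diffeological forms along `π : M → M / F`. -/
def projPullback (k : ℕ) : DForm F.LeafSpace k →ₗ[ℝ] ManifoldDForm n M k :=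
  @DForm.pullback M F.LeafSpace (manifoldDiffeology n M) _ F.proj F.dsmooth_proj k

end Foliation

end LeafDeRham

end

open CategoryTheory LeafDeRham

noncomputable section

namespace LeafDeRham

open Set Filter Topology Diffeology

/-! Plots of `M / F` lift locally to `M`, so `π^*` is injective, and a basic form `θ` can only
descend as the form whose value on a plot is `p^* θ` for local lifts `p`. The heart of the matter is
that this does not depend on the lift (`pull_eq_of_proj_eq`): if `π ∘ p = π ∘ p'` then `p^* θ = p'^*
θ`. For each `y` the points `p y` and `p' y` are joined by a chain of plaques, but the chain may
vary wildly with `y`.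

The remedy is a Baire argument. In a flat chart a submersion is affine, and projecting along its
fibres onto a transversal slice is a smooth map that preserves basic forms (`FlatChart.pull_slide`):
a basic form and its differential vanish on vertical vectors, so its coefficients are constant along
the fibres. As `M` is second countable, countably many composites of such slides suffice to bring
any two points of a leaf to a common point (`exists_countable_slides`). The sets where `g ∘ p = g' ∘
p'`, for `g` and `g'` among these slides, are therefore countably many and cover the domain. If `p^*
θ` and `p'^* θ` differed on a nonempty open set, one of these sets would contain a nonempty open
part of it, and there `p^* θ = (g ∘ p)^* θ = (g' ∘ p')^* θ = p'^* θ`.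

Conversely, let `η` come from the leaf space. Slides do not change the projection to `M / F`, so
they preserve `η`; they factor through the submersion, so `η` is killed by contraction with tangent
fields. The same holds for `dη`, which comes from the leaf space too, and Cartan's formula shows
that `η` is basic. Compatibility with `d` and with `H` is checked on plots, and the statement on
cohomology follows by functoriality. -/

/-! ### Flat charts of a submersion -/

/-- Near a point where its differential is onto, a smooth map is affine in suitable coordinates. -/
theorem exists_affine_coordinates {n q : ℕ} {f : E n → E q} {T : Set (E n)} (hT : IsOpen T)
    (hf : ContDiffOn ℝ ∞ f T) {a : E n} (ha : a ∈ T)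
    (hs : Function.Surjective (fderiv ℝ f a)) :
    ∃ (e : OpenPartialHomeomorph (E n) (E n)) (A : E n →L[ℝ] E q) (R : E q →L[ℝ] E n),
      (∀ v, A (R v) = v) ∧ a ∈ e.source ∧ e.source ⊆ T ∧ ContDiffOn ℝ ∞ e e.source ∧
      ContDiffOn ℝ ∞ e.symm e.target ∧ Convex ℝ e.target ∧ (∀ z ∈ e.target, R (A z) ∈ e.target) ∧
      ∀ z ∈ e.source, f z = A (e z) + f a := by
  set A := fderiv ℝ f a with hA
  obtain ⟨R, hR⟩ := A.exists_rightInverse_of_surjective (LinearMap.range_eq_top.2 hs)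
  have hR' : ∀ v, A (R v) = v := fun v => congrArg (fun L : E q →L[ℝ] E q => L v) hR
  -- Since `A ∘ R = id`, applying `A` to `G` gives `f - f a`; the term in `R` has zero derivative at
  -- `a`, so `G` has derivative `id` there.
  let G : E n → E n := fun z => (z - a) + R (f z - f a - A (z - a))
  have hG : ContDiffOn ℝ ∞ G T := by
    have h1 : ContDiffOn ℝ ∞ (fun z : E n => z - a) T := (contDiff_id.sub contDiff_const).contDiffOn
    exact h1.add (R.contDiff.comp_contDiffOn
      ((hf.sub contDiffOn_const).sub (A.contDiff.comp_contDiffOn h1)))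
  have hGa : HasFDerivAt G ((ContinuousLinearEquiv.refl ℝ (E n) : E n ≃L[ℝ] E n) :
      E n →L[ℝ] E n) a := by
    have h1 : HasFDerivAt (fun z : E n => z - a) (ContinuousLinearMap.id ℝ (E n)) a :=
      (hasFDerivAt_id a).sub_const a
    have h2 : HasFDerivAt f A a :=
      ((hf.contDiffAt (hT.mem_nhds ha)).differentiableAt (by simp)).hasFDerivAt
    have h3 := h1.add (R.hasFDerivAt.comp a ((h2.sub_const (f a)).sub (A.hasFDerivAt.comp a h1)))
    refine h3.congr_fderiv ?_
    ext v : 1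
    simp
  have hGc : ContDiffAt ℝ ∞ G a := hG.contDiffAt (hT.mem_nhds ha)
  let e₀ := hGc.toOpenPartialHomeomorph G hGa (by simp)
  have he₀ : ⇑e₀ = G := rfl
  have hae₀ : a ∈ e₀.source := hGc.mem_toOpenPartialHomeomorph_source hGa (by simp)
  -- The inverse function theorem gives a smooth inverse at one point only; on `I` the derivative of
  -- `G` is invertible everywhere, so the inverse is smooth on the whole target.
  let I : Set (E n) := T ∩ (fderiv ℝ G) ⁻¹' range ((↑) : (E n ≃L[ℝ] E n) → E n →L[ℝ] E n)
  have hI : IsOpen I :=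
    (hG.continuousOn_fderiv_of_isOpen hT (by simp)).isOpen_inter_preimage hT
      (ContinuousLinearEquiv.isOpen)
  have haI : a ∈ I := ⟨ha, ⟨_, hGa.fderiv.symm⟩⟩
  let e₁ := e₀.restrOpen I hI
  have hsrc₁ : e₁.source = e₀.source ∩ I := rfl
  have hsymm₁ : ContDiffOn ℝ ∞ e₁.symm e₁.target := by
    intro z hz
    have hz' := e₁.map_target hz
    obtain ⟨L, hL⟩ := hz'.2.2
    have hd : DifferentiableAt ℝ G (e₁.symm z) :=
      (hG.contDiffAt (hT.mem_nhds hz'.2.1)).differentiableAt (by simp)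
    refine (e₁.contDiffAt_symm (f₀' := L) hz ?_ ?_).contDiffWithinAt
    · rw [hL]; exact hd.hasFDerivAt
    · exact hG.contDiffAt (hT.mem_nhds hz'.2.1)
  have hGa0 : G a = 0 := by simp [G]
  have h0 : (0 : E n) ∈ e₁.target := by
    have := e₁.map_source (x := a) ⟨hae₀, haI⟩
    rwa [show e₁ a = G a from rfl, hGa0] at this
  obtain ⟨ε, hε, hb⟩ := Metric.isOpen_iff.1 e₁.open_target 0 h0
  let P : E n →L[ℝ] E n := R.comp A
  -- A ball need not be stable under `P`. Intersecting it with its preimage under `P` keeps it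
  -- convex and makes it stable, because `P ∘ P = P`.
  let N : Set (E n) := Metric.ball 0 ε ∩ P ⁻¹' Metric.ball 0 ε
  have hN : IsOpen N := Metric.isOpen_ball.inter (Metric.isOpen_ball.preimage P.continuous)
  let e := (e₁.symm.restrOpen N hN).symm
  have htgt : e.target = e₁.target ∩ N := rfl
  have htgt' : e.target = N := by
    rw [htgt]; exact inter_eq_right.2 fun z hz => hb hz.1
  have hsrc : e.source ⊆ e₁.source := by
    intro z hz
    exact hz.1
  refine ⟨e, A, R, hR', ?_, fun z hz => (hsrc hz).2.1, ?_, ?_, ?_, ?_, ?_⟩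
  · refine ⟨⟨hae₀, haI⟩, ?_⟩
    show e₁ a ∈ N
    rw [show e₁ a = G a from rfl, hGa0]
    refine ⟨Metric.mem_ball_self hε, ?_⟩
    rw [mem_preimage, map_zero]; exact Metric.mem_ball_self hε
  · exact hG.mono fun z hz => (hsrc hz).2.1
  · exact hsymm₁.mono fun z hz => hz.1
  · rw [htgt']
    exact (convex_ball _ _).inter ((convex_ball _ _).linear_preimage (P : E n →ₗ[ℝ] E n))
  · rw [htgt']
    intro z hz
    refine ⟨hz.2, ?_⟩
    rw [mem_preimage, show P (R (A z)) = P z from congrArg R (hR' (A z))]; exact hz.2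
  · intro z hz
    show f z = A (G z) + f a
    simp only [G, map_add, hR']
    abel

variable {n q : ℕ} {M : Type u} [TopologicalSpace M] [ChartedSpace (E n) M]

/-- A chart of `M` with convex range in which the submersion `s` is affine. -/
structure FlatChart (s : LocalSubmersion n q M) where
  dom : Set M
  isOpen_dom : IsOpen dom
  dom_subset : dom ⊆ s.dom
  tgt : Set (E n)
  isOpen_tgt : IsOpen tgt
  convex_tgt : Convex ℝ tgt
  chart : M → E n
  symm : E n → M
  chart_smooth : ContMDiffOn (𝓡 n) (𝓡 n) ∞ chart dom
  symm_smooth : ContMDiffOn (𝓡 n) (𝓡 n) ∞ symm tgt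
  mapsTo : ∀ x ∈ dom, chart x ∈ tgt
  mapsTo_symm : ∀ z ∈ tgt, symm z ∈ dom
  left_inv : ∀ x ∈ dom, symm (chart x) = x
  right_inv : ∀ z ∈ tgt, chart (symm z) = z
  lin : E n →L[ℝ] E q
  sec : E q →L[ℝ] E n
  lin_sec : ∀ v, lin (sec v) = v
  base : E q
  map_symm : ∀ z ∈ tgt, s.map (symm z) = lin z + base
  sec_lin_mem : ∀ z ∈ tgt, sec (lin z) ∈ tgt

/-- This is `exists_affine_coordinates` for `s.map` read in the preferred chart at `x`. The set `O`
serves to fit a flat chart into the overlap of two others. -/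
theorem exists_flatChart [IsManifold (𝓡 n) ∞ M] (s : LocalSubmersion n q M) {x : M}
    (hx : x ∈ s.dom) {O : Set M} (hO : IsOpen O) (hxO : x ∈ O) :
    ∃ C : FlatChart s, x ∈ C.dom ∧ C.dom ⊆ O := by
  let φ := extChartAt (𝓡 n) x
  have hφc : ContinuousOn φ φ.source := continuousOn_extChartAt x
  let T : Set (E n) := φ.target ∩ φ.symm ⁻¹' (s.dom ∩ O)
  have hT : IsOpen T := (continuousOn_extChartAt_symm x).isOpen_inter_preimage
    (isOpen_extChartAt_target x) (s.isOpen_dom.inter hO)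
  have hxs : x ∈ φ.source := mem_extChartAt_source x
  have hφx : φ.symm (φ x) = x := φ.left_inv hxs
  have haT : φ x ∈ T := ⟨φ.map_source hxs, by
    rw [mem_preimage, hφx]; exact ⟨hx, hxO⟩⟩
  have hfm : ContMDiffOn (𝓡 n) (𝓡 q) ∞ (s.map ∘ φ.symm) T :=
    s.smooth.comp ((contMDiffOn_extChartAt_symm x).mono inter_subset_left) fun z hz => hz.2.1
  have hf : ContDiffOn ℝ ∞ (s.map ∘ φ.symm) T := hfm.contDiffOn
  have hsurj : Function.Surjective (fderiv ℝ (s.map ∘ φ.symm) (φ x)) := by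
    have h1 : MDifferentiableAt (𝓡 n) (𝓡 n) φ.symm (φ x) :=
      (chart_symm_smooth x (φ.map_source hxs)).mdifferentiableAt (by simp)
    have h2 : MDifferentiableAt (𝓡 n) (𝓡 n) φ x :=
      (chart_smooth x hxs).mdifferentiableAt (by simp)
    have h3 : MDifferentiableAt (𝓡 n) (𝓡 q) s.map (φ.symm (φ x)) := by
      rw [hφx]
      exact (s.smooth.contMDiffAt (s.isOpen_dom.mem_nhds hx)).mdifferentiableAt (by simp)
    have e : s.map =ᶠ[𝓝 x] (s.map ∘ φ.symm) ∘ φ := by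
      filter_upwards [(isOpen_extChartAt_source (I := 𝓡 n) x).mem_nhds hxs] with t ht
      exact congrArg s.map (φ.left_inv ht).symm
    have h4 : tmap n q s.map x = (tmap n q (s.map ∘ φ.symm) (φ x)).comp (tmap n n φ x) := by
      rw [show tmap n q s.map x = _ from e.mfderiv_eq]
      exact mfderiv_comp x (h3.comp _ h1) h2
    rw [← tmap_eucl]
    intro v
    obtain ⟨w, hw⟩ := s.submersion x hx v
    rw [h4] at hw
    exact ⟨_, hw⟩
  obtain ⟨e, A, R, hAR, hae, hesub, he, hesymm, hconv, hRA, hfe⟩ :=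
    exists_affine_coordinates hT hf haT hsurj
  refine ⟨{
    dom := φ.source ∩ φ ⁻¹' e.source
    isOpen_dom := hφc.isOpen_inter_preimage (isOpen_extChartAt_source x) e.open_source
    dom_subset := fun y hy => by
      have h := (hesub hy.2).2.1
      rwa [φ.left_inv hy.1] at h
    tgt := e.target
    isOpen_tgt := e.open_target
    convex_tgt := hconv
    chart := e ∘ φ
    symm := φ.symm ∘ e.symm
    chart_smooth := he.contMDiffOn.comp
      (fun y hy => (chart_smooth x hy.1).contMDiffWithinAt) fun y hy => hy.2
    symm_smooth := (contMDiffOn_extChartAt_symm x).comp hesymm.contMDiffOn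
      fun z hz => (hesub (e.map_target hz)).1
    mapsTo := fun y hy => e.map_source hy.2
    mapsTo_symm := fun z hz => by
      have h1 := (hesub (e.map_target hz)).1
      refine ⟨φ.map_target h1, ?_⟩
      rw [mem_preimage, Function.comp_apply, φ.right_inv h1]; exact e.map_target hz
    left_inv := fun y hy => by
      show φ.symm (e.symm (e (φ y))) = y
      rw [e.left_inv hy.2, φ.left_inv hy.1]
    right_inv := fun z hz => by
      show e (φ (φ.symm (e.symm z))) = z
      rw [φ.right_inv (hesub (e.map_target hz)).1, e.right_inv hz]
    lin := A
    sec := R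
    lin_sec := hAR
    base := s.map (φ.symm (φ x))
    map_symm := fun z hz => by
      have h := hfe _ (e.map_target hz)
      rwa [e.right_inv hz] at h
    sec_lin_mem := hRA }, ⟨hxs, hae⟩, fun y hy => ?_⟩
  have h := (hesub hy.2).2.2
  rwa [φ.left_inv hy.1] at h

namespace FlatChart

variable {s : LocalSubmersion n q M} (C : FlatChart s)

/-- The domain of the local section of the submersion given by a flat chart. -/
def sliceDom : Set (E q) := (fun b => C.sec (b - C.base)) ⁻¹' C.tgt

/-- The local section of the submersion given by a flat chart. -/
def slice (b : E q) : M := C.symm (C.sec (b - C.base))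

/-- The retraction onto the image of the local section along the fibres of the submersion. -/
def slide (x : M) : M := C.slice (s.map x)

theorem isOpen_sliceDom : IsOpen C.sliceDom :=
  C.isOpen_tgt.preimage (C.sec.continuous.comp (continuous_id.sub continuous_const))

theorem map_eq {x : M} (hx : x ∈ C.dom) : s.map x = C.lin (C.chart x) + C.base := by
  have h := C.map_symm _ (C.mapsTo x hx)
  rwa [C.left_inv x hx] at h

theorem sec_map {x : M} (hx : x ∈ C.dom) :
    C.sec (s.map x - C.base) = C.sec (C.lin (C.chart x)) := by
  rw [C.map_eq hx, add_sub_cancel_right]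

theorem map_mem_sliceDom {x : M} (hx : x ∈ C.dom) : s.map x ∈ C.sliceDom := by
  show C.sec (s.map x - C.base) ∈ C.tgt
  rw [C.sec_map hx]
  exact C.sec_lin_mem _ (C.mapsTo x hx)

theorem slice_mem {b : E q} (hb : b ∈ C.sliceDom) : C.slice b ∈ C.dom := C.mapsTo_symm _ hb

theorem map_slice {b : E q} (hb : b ∈ C.sliceDom) : s.map (C.slice b) = b := by
  show s.map (C.symm _) = b
  rw [C.map_symm _ hb, C.lin_sec, sub_add_cancel]

theorem slice_smooth : ContMDiffOn (𝓡 q) (𝓡 n) ∞ C.slice C.sliceDom :=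
  C.symm_smooth.comp (C.sec.contDiff.comp (contDiff_id.sub contDiff_const)).contMDiff.contMDiffOn
    fun _ h => h

theorem slide_mem {x : M} (hx : x ∈ C.dom) : C.slide x ∈ C.dom :=
  C.slice_mem (C.map_mem_sliceDom hx)

theorem map_slide {x : M} (hx : x ∈ C.dom) : s.map (C.slide x) = s.map x :=
  C.map_slice (C.map_mem_sliceDom hx)

/-- The slide sees a point only through `s.map`, even outside `C.dom`; `FlatChart.shift` rests on
this. -/
theorem slide_eq {x y : M} (h : s.map x = s.map y) : C.slide x = C.slide y :=
  congrArg C.slice h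

theorem slide_smooth : ContMDiffOn (𝓡 n) (𝓡 n) ∞ C.slide C.dom :=
  C.slice_smooth.comp (s.smooth.mono C.dom_subset) fun _ => C.map_mem_sliceDom

theorem slide_eq_symm {x : M} (hx : x ∈ C.dom) :
    C.slide x = C.symm (C.sec (C.lin (C.chart x))) := congrArg C.symm (C.sec_map hx)

/-- By convexity the segment between the coordinates of the points stays in the chart, and `lin` is
constant on it; its image is the connected set required. -/
theorem samePlaque {F : Foliation n q M} (hs : s ∈ F.family) {x y : M} (hx : x ∈ C.dom)
    (hy : y ∈ C.dom) (h : s.map x = s.map y) : F.SamePlaque x y := by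
  have hseg : segment ℝ (C.chart x) (C.chart y) ⊆ C.tgt :=
    C.convex_tgt.segment_subset (C.mapsTo x hx) (C.mapsTo y hy)
  have hlin : C.lin (C.chart x) = C.lin (C.chart y) := by
    have := h
    rwa [C.map_eq hx, C.map_eq hy, add_left_inj] at this
  refine ⟨s, hs, C.symm '' segment ℝ (C.chart x) (C.chart y), ?_, ?_, ?_, ?_, ?_⟩
  · rintro _ ⟨z, hz, rfl⟩
    exact C.dom_subset (C.mapsTo_symm z (hseg hz))
  · exact (convex_segment _ _).isPreconnected.image _ (C.symm_smooth.continuousOn.mono hseg)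
  · exact ⟨_, left_mem_segment ℝ _ _, C.left_inv x hx⟩
  · exact ⟨_, right_mem_segment ℝ _ _, C.left_inv y hy⟩
  · rintro _ ⟨z, hz, rfl⟩
    rw [C.map_symm z (hseg hz), C.map_eq hx]
    obtain ⟨a, b, -, -, hab, rfl⟩ := hz
    rw [map_add, map_smul, map_smul, ← hlin, ← add_smul, hab, one_smul]

end FlatChart

/-! ### Forms that are constant along the fibres of a linear map -/

section Linear

variable {n q k : ℕ} {A : E n →L[ℝ] E q} {R : E q →L[ℝ] E n}

/-- A multilinear map that vanishes on the kernel of `A` factors through `A`. -/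
theorem apply_comp_of_horizontal (hAR : ∀ v, A (R v) = v) {η : Alt n k}
    (h : ∀ u : Fin k → E n, (∃ i, A (u i) = 0) → η u = 0) (w : Fin k → E n) :
    η (fun i => R (A (w i))) = η w := by
  classical
  -- The entries are replaced one at a time; each replacement alters an entry by a vector in the
  -- kernel of `A`.
  have key : ∀ S : Finset (Fin k), η (S.piecewise (fun i => R (A (w i))) w) = η w := by
    intro S
    induction S using Finset.induction_on with
    | empty => simp
    | insert j S hj ih =>
      rw [← ih, Finset.piecewise_insert, ← sub_eq_zero]
      have e : S.piecewise (fun i => R (A (w i))) w =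
          Function.update (S.piecewise (fun i => R (A (w i))) w) j (w j) := by
        rw [eq_comm, Function.update_eq_self_iff, Finset.piecewise_eq_of_notMem _ _ _ hj]
      conv_lhs => rw [e]
      rw [Function.update_idem, ← ContinuousAlternatingMap.map_update_sub]
      exact h _ ⟨j, by rw [Function.update_self, map_sub, hAR, sub_self]⟩
  simpa using key Finset.univ

/-- A form on a convex set that, with its differential, vanishes on the kernel of `A` is pulled
back from its restriction to the image of a section of `A`. -/
theorem eq_pullback_of_horizontal (hAR : ∀ v, A (R v) = v) {W : Set (E n)} (hW : IsOpen W)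
    (hc : Convex ℝ W) (hRA : ∀ z ∈ W, R (A z) ∈ W) {η : E n → Alt n k}
    (hη : ContDiffOn ℝ ∞ η W)
    (h0 : ∀ z ∈ W, ∀ u : Fin k → E n, (∃ i, A (u i) = 0) → η z u = 0)
    (h1 : ∀ z ∈ W, ∀ u : Fin (k + 1) → E n, (∃ i, A (u i) = 0) → extDeriv η z u = 0)
    {z : E n} (hz : z ∈ W) :
    η z = (η (R (A z))).compContinuousLinearMap (R.comp A) := by
  ext w
  have hd : ∀ y ∈ W, DifferentiableAt ℝ η y := fun y hy =>
    (hη.contDiffAt (hW.mem_nhds hy)).differentiableAt (by simp)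
  have hdw : ∀ (u : Fin k → E n), ∀ y ∈ W, DifferentiableAt ℝ (fun y => η y u) y := fun u y hy =>
    ((ContinuousAlternatingMap.apply ℝ (E n) ℝ u).differentiableAt).comp y (hd y hy)
  -- In `extDeriv η` at `(v, w)`, every term but the first differentiates `η` on a tuple that still
  -- contains `v`, which is identically zero on `W`. What is left is the derivative of `η w` along
  -- `v`.
  have hker : ∀ y ∈ W, ∀ v, A v = 0 → fderiv ℝ (fun y => η y w) y v = 0 := by
    intro y hy v hv
    have h := h1 y hy (Fin.cons v w) ⟨0, by simpa using hv⟩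
    rw [extDeriv_apply (hd y hy), Fin.sum_univ_succ] at h
    rw [Finset.sum_eq_zero, add_zero] at h
    · simpa using h
    · intro i _
      have hz : (fun y => η y (i.succ.removeNth (Fin.cons v w : Fin (k + 1) → E n)))
          =ᶠ[𝓝 y] fun _ => 0 := by
        filter_upwards [hW.mem_nhds hy] with t ht
        refine h0 t ht _ ?_
        cases k with
        | zero => exact i.elim0
        | succ k => exact ⟨0, by simpa [Fin.removeNth] using hv⟩
      rw [hz.fderiv_eq]
      simp
  -- The segment from `R (A z)` to `z` has its direction in the kernel of `A`, so `η w` is constant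
  -- along it.
  have hseg : ∀ t ∈ Icc (0 : ℝ) 1, R (A z) + t • (z - R (A z)) ∈ W := fun t ht =>
    hc.add_smul_sub_mem (hRA z hz) hz ht
  have hder : ∀ t ∈ Icc (0 : ℝ) 1,
      HasDerivAt (fun t : ℝ => η (R (A z) + t • (z - R (A z))) w) 0 t := by
    intro t ht
    have hl : HasDerivAt (fun t : ℝ => R (A z) + t • (z - R (A z))) (z - R (A z)) t := by
      simpa using ((hasDerivAt_id t).smul_const (z - R (A z))).const_add (R (A z))
    have h := (hdw w _ (hseg t ht)).hasFDerivAt.comp_hasDerivAt t hl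
    rwa [hker _ (hseg t ht) _ (by rw [map_sub, hAR, sub_self])] at h
  have hconst := constant_of_has_deriv_right_zero
    (fun t ht => (hder t ht).continuousAt.continuousWithinAt)
    (fun t ht => (hder t (Ico_subset_Icc_self ht)).hasDerivWithinAt) 1 (right_mem_Icc.2 zero_le_one)
  simp only [one_smul, add_sub_cancel, zero_smul, add_zero] at hconst
  rw [hconst]
  exact (apply_comp_of_horizontal hAR (h0 _ (hRA z hz)) w).symm

end Linear

/-! ### Basic forms in flat charts -/

/-- An alternating map vanishes on tuples containing `v` if its contraction with `v` is zero. -/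
theorem apply_eq_zero_of_curryLeft {n k : ℕ} {f : Alt n (k + 1)} {u : Fin (k + 1) → E n}
    {i : Fin (k + 1)} (h : f.curryLeft (u i) = 0) : f u = 0 := by
  have key : ∀ w : Fin (k + 1) → E n, w 0 = u i → f w = 0 := by
    intro w hw
    have h2 := congrArg (fun g : Alt n k => g (Fin.tail w)) h
    simp only [ContinuousAlternatingMap.curryLeft_apply_apply] at h2
    rw [← Fin.cons_self_tail w, hw]
    exact h2
  by_cases hi : i = 0
  · exact key u (by rw [hi])
  · have h2 := f.toAlternatingMap.map_swap (v := u) (i := i) (j := 0) hi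
    have h3 : f.toAlternatingMap (u ∘ Equiv.swap i 0) = 0 := key _ (by simp)
    rw [h3] at h2
    exact neg_eq_zero.1 h2.symm

variable [IsManifold (𝓡 n) ∞ M]

theorem LocalSubmersion.mdifferentiableAt (s : LocalSubmersion n q M) {x : M} (hx : x ∈ s.dom) :
    MDifferentiableAt (𝓡 n) (𝓡 q) s.map x :=
  (s.smooth.contMDiffAt (s.isOpen_dom.mem_nhds hx)).mdifferentiableAt (by simp)

/-- The kernels of the differentials of the submersions of a foliation agree. -/
theorem Foliation.tmap_eq_zero (F : Foliation n q M) {s t : LocalSubmersion n q M}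
    (hs : s ∈ F.family) (ht : t ∈ F.family) {x : M} (hxs : x ∈ s.dom) (hxt : x ∈ t.dom) {v : E n}
    (h : tmap n q s.map x v = 0) : tmap n q t.map x v = 0 := by
  obtain ⟨φ, hφ, hφs, -, e⟩ := F.compatible s hs t ht x ⟨hxs, hxt⟩
  have hd : MDifferentiableAt (𝓡 q) (𝓡 q) φ (s.map x) :=
    ((hφs.contDiffAt (φ.open_source.mem_nhds hφ)).differentiableAt (by simp)).mdifferentiableAt
  have e1 : tmap n q t.map x = tmap n q (φ ∘ s.map) x := e.mfderiv_eq
  have e2 : tmap n q (φ ∘ s.map) x = (tmap q q φ (s.map x)).comp (tmap n q s.map x) :=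
    mfderiv_comp x hd (s.mdifferentiableAt hxs)
  rw [e1, e2]
  exact (congrArg (tmap q q φ (s.map x)) h).trans (map_zero _)

namespace FlatChart

variable {s : LocalSubmersion n q M} (C : FlatChart s)

theorem symm_contMDiffAt {z : E n} (hz : z ∈ C.tgt) : ContMDiffAt (𝓡 n) (𝓡 n) ∞ C.symm z :=
  C.symm_smooth.contMDiffAt (C.isOpen_tgt.mem_nhds hz)

theorem chart_contMDiffAt {x : M} (hx : x ∈ C.dom) : ContMDiffAt (𝓡 n) (𝓡 n) ∞ C.chart x :=
  C.chart_smooth.contMDiffAt (C.isOpen_dom.mem_nhds hx)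

theorem tmap_symm_tangent {z : E n} (hz : z ∈ C.tgt) {v : E n} (hv : C.lin v = 0) :
    tmap n q s.map (C.symm z) (tmap n n C.symm z v) = 0 := by
  have hd := (C.symm_contMDiffAt hz).mdifferentiableAt (by simp)
  have e : s.map ∘ C.symm =ᶠ[𝓝 z] fun y => C.lin y + C.base := by
    filter_upwards [C.isOpen_tgt.mem_nhds hz] with y hy using C.map_symm y hy
  have h1 : tmap n q (s.map ∘ C.symm) z =
      (tmap n q s.map (C.symm z)).comp (tmap n n C.symm z) :=
    mfderiv_comp z (s.mdifferentiableAt (C.dom_subset (C.mapsTo_symm z hz))) hd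
  have h2 : tmap n q (s.map ∘ C.symm) z = C.lin := by
    rw [tmap_eucl (s.map ∘ C.symm), e.fderiv_eq, fderiv_add_const, C.lin.fderiv]
  have h3 : (tmap n q s.map (C.symm z)).comp (tmap n n C.symm z) v = 0 := by
    rw [← h1, h2, hv]
  exact h3

/-- A vector tangent to the fibres extends to a vector field tangent to the foliation. -/
theorem exists_tangent_field [T2Space M] {F : Foliation n q M} (hs : s ∈ F.family) {z : E n}
    (hz : z ∈ C.tgt) {v : E n} (hv : C.lin v = 0) :
    ∃ X : M → E n, IsSmoothField X ∧ F.IsTangent X ∧ X (C.symm z) = tmap n n C.symm z v := by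
  -- The constant field `v` of the coordinates, carried to `C.dom`; a bump function supported in
  -- `C.dom` then extends it by zero.
  let T : M → E n := fun y => tmap n n C.symm (C.chart y) v
  have hT : ContMDiffOn (𝓡 n) (𝓡 n).tangent ∞
      (fun y => (⟨y, T y⟩ : TangentBundle (𝓡 n) M)) C.dom := by
    have h1 : ContMDiff (𝓡 n) (𝓡 n).tangent ∞
        (fun y : E n => (⟨y, v⟩ : TangentBundle (𝓡 n) (E n))) :=
      contMDiff_vectorSpace_iff_contDiff.2 contDiff_const
    have : IsManifold (𝓡 n) 1 M := IsManifold.of_le (n := ∞) (by simp)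
    have h2 := C.symm_smooth.contMDiffOn_tangentMapWithin (m := ∞) (by simp)
      C.isOpen_tgt.uniqueMDiffOn
    have h3 := h2.comp (h1.comp_contMDiffOn C.chart_smooth) fun y hy => C.mapsTo y hy
    refine h3.congr fun y hy => ?_
    have key : ∀ (a : M) (w : E n), a = y → (⟨y, w⟩ : TangentBundle (𝓡 n) M) = ⟨a, w⟩ := by
      rintro a w rfl; rfl
    have e : T y = mfderivWithin (𝓡 n) (𝓡 n) C.symm C.tgt (C.chart y) v := by
      show mfderiv (𝓡 n) (𝓡 n) C.symm (C.chart y) v = _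
      rw [mfderivWithin_of_isOpen C.isOpen_tgt (C.mapsTo y hy)]
    rw [e]
    exact key _ _ (C.left_inv y hy)
  have hx : C.symm z ∈ C.dom := C.mapsTo_symm z hz
  obtain ⟨ψ, -, hψ⟩ := (SmoothBumpFunction.nhds_basis_tsupport (I := 𝓡 n) (C.symm z)).mem_iff.1
    (C.isOpen_dom.mem_nhds hx)
  refine ⟨fun y => ψ y • T y, ?_, ?_, ?_⟩
  · exact ContMDiffOn.smul_section_of_tsupport (V := fun x : M => TangentSpace (𝓡 n) x)
      ψ.contMDiff.contMDiffOn C.isOpen_dom hψ hT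
  · intro t ht y hy
    by_cases hyC : y ∈ C.dom
    · have h := C.tmap_symm_tangent (C.mapsTo y hyC) hv
      rw [C.left_inv y hyC] at h
      rw [map_smul, F.tmap_eq_zero hs ht (C.dom_subset hyC) hy h, smul_zero]
    · have h0 : ψ y • T y = 0 := by
        rw [image_eq_zero_of_notMem_tsupport fun h => hyC (hψ h), zero_smul]
      exact (congrArg (tmap n q t.map y) h0).trans (map_zero _)
  · show ψ (C.symm z) • T (C.symm z) = _
    rw [ψ.eq_one, one_smul]
    show tmap n n C.symm (C.chart (C.symm z)) v = _
    rw [C.right_inv z hz]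

/-- Basic forms are invariant under sliding along the fibres. -/
theorem pull_slide [T2Space M] {F : Foliation n q M} (hs : s ∈ F.family) {k : ℕ}
    (θ : F.BasicForm k) {x : M} (hx : x ∈ C.dom) : pull n n C.slide θ.1 x = θ.1 x := by
  let η : E n → Alt n k := pull n n C.symm θ.1
  let θ' : MForm n M k := F.basicToMForm k θ
  have hb := (F.isBasic_iff θ.1).1 θ.2.2
  have hη : ContDiffOn ℝ ∞ η C.tgt := fun z hz =>
    (pull_smooth θ' (C.symm_contMDiffAt hz)).contDiffWithinAt
  -- Basicness speaks of global vector fields. Extending a single vertical vector to a tangent field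
  -- turns it into a pointwise condition, for `η` here and for its differential in `h1`.
  have h0 : ∀ z ∈ C.tgt, ∀ u : Fin k → E n, (∃ i, C.lin (u i) = 0) → η z u = 0 := by
    rintro z hz u ⟨i, hi⟩
    obtain ⟨X, hX, hXT, hXz⟩ := C.exists_tangent_field hs hz hi
    cases k with
    | zero => exact i.elim0
    | succ k =>
      have h := congrFun (hb X hX hXT).1 (C.symm z)
      have h' : (θ.1 (C.symm z)).curryLeft (X (C.symm z)) = 0 := h
      rw [hXz] at h'
      exact apply_eq_zero_of_curryLeft (f := θ.1 (C.symm z))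
        (u := fun j => tmap n n C.symm z (u j)) (i := i) h'
  have h1 : ∀ z ∈ C.tgt, ∀ u : Fin (k + 1) → E n, (∃ i, C.lin (u i) = 0) →
      extDeriv η z u = 0 := by
    rintro z hz u ⟨i, hi⟩
    obtain ⟨X, hX, hXT, hXz⟩ := C.exists_tangent_field hs hz hi
    have h := congrFun (hb X hX hXT).2 (C.symm z)
    have h' : (dRaw θ.1 (C.symm z)).curryLeft (X (C.symm z)) = 0 := h
    rw [hXz] at h'
    rw [show extDeriv η z = pull n n C.symm (dRaw θ.1) z from
      (pull_dRaw θ' (C.symm_contMDiffAt hz)).symm]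
    exact apply_eq_zero_of_curryLeft (f := dRaw θ.1 (C.symm z))
      (u := fun j => tmap n n C.symm z (u j)) (i := i) h'
  -- In coordinates the slide is the linear projection `P`, and `P^* η = η` by
  -- `eq_pullback_of_horizontal`.
  let P : E n →L[ℝ] E n := C.sec.comp C.lin
  have hz := C.mapsTo x hx
  have hP : pull n n P η (C.chart x) = η (C.chart x) := by
    rw [pull_eucl, P.fderiv]
    exact (eq_pullback_of_horizontal C.lin_sec C.isOpen_tgt C.convex_tgt C.sec_lin_mem hη h0 h1
      hz).symm
  have hc := (C.chart_contMDiffAt hx).mdifferentiableAt (by simp)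
  have hPd : MDifferentiableAt (𝓡 n) (𝓡 n) P (C.chart x) :=
    P.differentiableAt.mdifferentiableAt
  have e1 : C.slide =ᶠ[𝓝 x] C.symm ∘ (P ∘ C.chart) := by
    filter_upwards [C.isOpen_dom.mem_nhds hx] with y hy using C.slide_eq_symm hy
  have e2 : C.symm ∘ C.chart =ᶠ[𝓝 x] id := by
    filter_upwards [C.isOpen_dom.mem_nhds hx] with y hy using C.left_inv y hy
  have hs1 : MDifferentiableAt (𝓡 n) (𝓡 n) C.symm ((P ∘ C.chart) x) :=
    (C.symm_contMDiffAt (C.sec_lin_mem _ hz)).mdifferentiableAt (by simp)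
  have hs2 := (C.symm_contMDiffAt hz).mdifferentiableAt (by simp)
  rw [pull_congr e1, pull_comp (m := n) hs1 (hPd.comp x hc)]
  show pull n n (P ∘ C.chart) η x = _
  rw [pull_comp (m := n) hPd hc]
  have e3 : pull n n C.chart (pull n n P η) x = pull n n C.chart η x :=
    congrArg (fun ζ : Alt n k => ζ.compContinuousLinearMap (tmap n n C.chart x)) hP
  have h2 : tmap n n (id : M → M) x = ContinuousLinearMap.id ℝ (E n) := mfderiv_id
  rw [e3, ← pull_comp (m := n) hs2 hc, pull_congr e2]
  simp only [pull, h2]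
  rfl

end FlatChart

/-! ### Slides and lifts of plots of the leaf space -/

namespace Foliation

/-- A smooth map from an open subset of `M` to `M` that preserves all basic forms. -/
structure Slide (F : Foliation n q M) where
  dom : Set M
  isOpen_dom : IsOpen dom
  map : M → M
  smooth : ContMDiffOn (𝓡 n) (𝓡 n) ∞ map dom
  pull_eq : ∀ (k : ℕ) (θ : F.BasicForm k), ∀ x ∈ dom, pull n n map θ.1 x = θ.1 x

variable {F : Foliation n q M}

theorem Slide.contMDiffAt (g : F.Slide) {x : M} (hx : x ∈ g.dom) :
    ContMDiffAt (𝓡 n) (𝓡 n) ∞ g.map x :=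
  g.smooth.contMDiffAt (g.isOpen_dom.mem_nhds hx)

theorem Slide.pull_comp_eq (g : F.Slide) {k m : ℕ} (θ : F.BasicForm k) {p : E m → M} {y : E m}
    (hp : ContMDiffAt (𝓡 m) (𝓡 n) ∞ p y) (hy : p y ∈ g.dom) :
    pull m n (g.map ∘ p) θ.1 y = pull m n p θ.1 y := by
  rw [pull_comp (m := n) ((g.contMDiffAt hy).mdifferentiableAt (by simp))
    (hp.mdifferentiableAt (by simp))]
  exact congrArg (fun ζ : Alt n k => ζ.compContinuousLinearMap (tmap m n p y))
    (g.pull_eq k θ _ hy)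

/-- Composition of slides. -/
def Slide.comp (g f : F.Slide) : F.Slide where
  dom := f.dom ∩ f.map ⁻¹' g.dom
  isOpen_dom := f.smooth.continuousOn.isOpen_inter_preimage f.isOpen_dom g.isOpen_dom
  map := g.map ∘ f.map
  smooth := g.smooth.comp (f.smooth.mono inter_subset_left) fun _ h => h.2
  pull_eq k θ x hx := by
    rw [pull_comp (m := n) ((g.contMDiffAt hx.2).mdifferentiableAt (by simp))
      ((f.contMDiffAt hx.1).mdifferentiableAt (by simp))]
    refine Eq.trans ?_ (f.pull_eq k θ x hx.1)
    exact congrArg (fun ζ : Alt n k => ζ.compContinuousLinearMap (tmap n n f.map x))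
      (g.pull_eq k θ _ hx.2)

variable [T2Space M]

/-- The slide of a flat chart. -/
def _root_.LeafDeRham.FlatChart.toSlide {s : LocalSubmersion n q M} (C : FlatChart s)
    (hs : s ∈ F.family) : F.Slide where
  dom := C.dom
  isOpen_dom := C.isOpen_dom
  map := C.slide
  smooth := C.slide_smooth
  pull_eq _ θ _ hx := C.pull_slide hs θ hx

/-- The slide in a flat chart `C` to the local section of a smaller flat chart `D`. -/
def _root_.LeafDeRham.FlatChart.shift {s : LocalSubmersion n q M} (C D : FlatChart s)
    (hs : s ∈ F.family) (hD : D.dom ⊆ C.dom) : F.Slide where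
  dom := C.dom ∩ s.map ⁻¹' D.sliceDom
  isOpen_dom := (s.smooth.continuousOn.mono C.dom_subset).isOpen_inter_preimage C.isOpen_dom
    D.isOpen_sliceDom
  map := D.slide
  smooth := D.slice_smooth.comp (s.smooth.mono fun _ h => C.dom_subset h.1) fun _ h => h.2
  pull_eq k θ x hx := by
    have ho : IsOpen (C.dom ∩ s.map ⁻¹' D.sliceDom) :=
      (s.smooth.continuousOn.mono C.dom_subset).isOpen_inter_preimage C.isOpen_dom
        D.isOpen_sliceDom
    have hsm : ContMDiffAt (𝓡 n) (𝓡 n) ∞ D.slide x :=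
      (D.slice_smooth.comp (s.smooth.mono fun _ h => C.dom_subset h.1)
        fun _ h => h.2).contMDiffAt (ho.mem_nhds hx)
    have hD' : D.slide x ∈ C.dom := hD (D.slice_mem hx.2)
    -- The point `x` may lie outside `D.dom`, where `pull_slide` for `D` says nothing. But `D.slide`
    -- preserves `s.map`, so `C.slide` absorbs it, and invariance under `C.slide` at both `x` and
    -- `D.slide x` gives the claim.
    have e : C.slide =ᶠ[𝓝 x] C.slide ∘ D.slide := by
      filter_upwards [ho.mem_nhds hx] with y hy
      exact C.slide_eq (D.map_slice hy.2).symm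
    have hCd : ContMDiffAt (𝓡 n) (𝓡 n) ∞ C.slide (D.slide x) := (C.toSlide hs).contMDiffAt hD'
    rw [← C.pull_slide hs θ hx.1, pull_congr e, pull_comp (m := n)
      (hCd.mdifferentiableAt (by simp))
      (hsm.mdifferentiableAt (by simp))]
    exact (congrArg (fun ζ : Alt n k => ζ.compContinuousLinearMap (tmap n n D.slide x))
      (C.pull_slide hs θ hD')).symm

/-- Countably many slides realize all changes from one flat chart to another. -/
theorem exists_transition_slides [SecondCountableTopology M] {s t : LocalSubmersion n q M}
    (hs : s ∈ F.family) (ht : t ∈ F.family) (C : FlatChart s) (B : FlatChart t) :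
    ∃ T : Set F.Slide, T.Countable ∧ ∀ y ∈ C.dom ∩ B.dom, ∃ g ∈ T,
      C.slide y ∈ g.dom ∧ g.map (C.slide y) = B.slide y := by
  -- By compatibility, `t.map` is a function of `s.map` on a small enough `D`.
  have hD : ∀ x ∈ C.dom ∩ B.dom, ∃ D : FlatChart s, x ∈ D.dom ∧ D.dom ⊆ C.dom ∩ B.dom ∧
      ∀ y ∈ D.dom, ∀ z ∈ D.dom, s.map y = s.map z → t.map y = t.map z := by
    intro x hx
    obtain ⟨φ, -, -, -, e⟩ := F.compatible s hs t ht x ⟨C.dom_subset hx.1, B.dom_subset hx.2⟩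
    obtain ⟨N, hN, hNo, hxN⟩ := eventually_nhds_iff.1 e
    obtain ⟨D, hxD, hDO⟩ := exists_flatChart s (C.dom_subset hx.1)
      ((C.isOpen_dom.inter B.isOpen_dom).inter hNo) ⟨hx, hxN⟩
    refine ⟨D, hxD, fun y hy => (hDO hy).1, fun y hy z hz h => ?_⟩
    rw [hN y (hDO hy).2, hN z (hDO hz).2]
    exact congrArg φ h
  have : Nonempty (FlatChart s) := ⟨C⟩
  choose! D hxD hDsub hDt using hD
  obtain ⟨K, hK, hKc, hcov⟩ := TopologicalSpace.countable_cover_nhdsWithin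
    (f := fun x => (D x).dom) (s := C.dom ∩ B.dom)
    fun x hx => mem_nhdsWithin_of_mem_nhds ((D x).isOpen_dom.mem_nhds (hxD x hx))
  -- The slide attached to `x` moves along the fibres of `s` to the slice of `D x`, which lies in
  -- `B.dom`, and then slides in `B`.
  have hKc' : Countable K := hKc.to_subtype
  refine ⟨range fun x : K => (B.toSlide ht).comp
    (C.shift (D x) hs fun y hy => (hDsub x (hK x.2) hy).1), countable_range _, fun y hy => ?_⟩
  obtain ⟨x, hxK, hyx⟩ := mem_iUnion₂.1 (hcov hy)
  have hy1 := (D x).map_mem_sliceDom hyx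
  have hmap : s.map (C.slide y) = s.map y := C.map_slide hy.1
  have hy2 : s.map (C.slide y) ∈ (D x).sliceDom := by rwa [hmap]
  have hy3 : (D x).slide (C.slide y) = (D x).slide y := (D x).slide_eq hmap
  have hy4 := (D x).slide_mem hyx
  refine ⟨_, ⟨⟨x, hxK⟩, rfl⟩, ⟨⟨C.slide_mem hy.1, hy2⟩, ?_⟩, ?_⟩
  · show (D x).slide (C.slide y) ∈ B.dom
    rw [hy3]
    exact (hDsub x (hK hxK) hy4).2
  · show B.slide ((D x).slide (C.slide y)) = B.slide y
    rw [hy3]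
    exact B.slide_eq (hDt x (hK hxK) _ hy4 _ hyx ((D x).map_slide hyx))

theorem SamePlaque.symm {x y : M} (h : F.SamePlaque x y) : F.SamePlaque y x := by
  obtain ⟨s, hs, K, hK, hKc, hx, hy, h⟩ := h
  exact ⟨s, hs, K, hK, hKc, hy, hx, fun z hz => (h z hz).trans (h y hy).symm⟩

/-- Countably many slides detect the leaves. -/
theorem exists_countable_slides [SecondCountableTopology M] (F : Foliation n q M) :
    ∃ S : Set F.Slide, S.Countable ∧ ∀ x y, F.proj x = F.proj y →
      ∃ g ∈ S, ∃ g' ∈ S, x ∈ g.dom ∧ y ∈ g'.dom ∧ g.map x = g'.map y := by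
  choose s hs hxs using F.cover
  have hC : ∀ x, ∃ C : FlatChart (s x), x ∈ C.dom := fun x =>
    (exists_flatChart (s x) (hxs x) isOpen_univ (mem_univ x)).imp fun _ h => h.1
  choose C hxC using hC
  obtain ⟨I, hI, hcov⟩ := TopologicalSpace.countable_cover_nhds
    (f := fun x => (C x).dom) fun x => (C x).isOpen_dom.mem_nhds (hxC x)
  have hcov' : ∀ y, ∃ i ∈ I, y ∈ (C i).dom := fun y => by
    simpa using (hcov.symm ▸ mem_univ y : y ∈ ⋃ x ∈ I, (C x).dom)
  choose T hT hTs using fun i j => exists_transition_slides (hs i) (hs j) (C i) (C j)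
  let G : Set F.Slide := ⋃ i ∈ I, ⋃ j ∈ I, T i j
  have hG : G.Countable := hI.biUnion fun i _ => hI.biUnion fun j _ => hT i j
  -- `S N` consists of a slide of one chart followed by `N` transition slides; it stays countable.
  let S : ℕ → Set F.Slide := fun N => Nat.rec ((fun i => (C i).toSlide (hs i)) '' I)
    (fun _ S => image2 Slide.comp G S) N
  have hS0 : S 0 = (fun i => (C i).toSlide (hs i)) '' I := rfl
  have hSs : ∀ N, S (N + 1) = image2 Slide.comp G (S N) := fun _ => rfl
  have hSc : ∀ N, (S N).Countable := by
    intro N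
    induction N with
    | zero => rw [hS0]; exact hI.image _
    | succ N ih => rw [hSs]; exact hG.image2 ih _
  -- All charts around `y` are required at once, so that a chain may continue in whichever chart is
  -- convenient.
  let Rel : M → M → Prop := fun x y => ∀ j ∈ I, y ∈ (C j).dom →
    ∃ N, ∃ g ∈ S N, x ∈ g.dom ∧ g.map x = (C j).slide y
  have hrefl : ∀ x, Rel x x := fun x j hj hx => ⟨0, _, ⟨j, hj, rfl⟩, hx, rfl⟩
  -- Moving from `y` to `z` inside a fibre of chart `i` does not change the slide in that chart; a
  -- transition slide at `z` then leads to chart `j`.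
  have hstep : ∀ x y z, Rel x y → ∀ i ∈ I, y ∈ (C i).dom → z ∈ (C i).dom →
      (s i).map y = (s i).map z → Rel x z := by
    intro x y z h i hi hy hz hyz j hj hzj
    obtain ⟨N, g, hg, hxg, hgx⟩ := h i hi hy
    obtain ⟨f, hf, hzf, hfz⟩ := hTs i j z ⟨hz, hzj⟩
    rw [(C i).slide_eq hyz] at hgx
    refine ⟨N + 1, f.comp g, ⟨f, ?_, g, hg, rfl⟩, ⟨hxg, ?_⟩, ?_⟩
    · exact mem_iUnion₂.2 ⟨i, hi, mem_iUnion₂.2 ⟨j, hj, hf⟩⟩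
    · rw [mem_preimage, hgx]; exact hzf
    · show f.map (g.map x) = _
      rw [hgx, hfz]
  have hplaque : ∀ x y z, F.SamePlaque y z → Rel x y → Rel x z := by
    rintro x y z ⟨t, ht, K, hK, hKc, hy, hz, hKt⟩
    -- The connected set `K` need not fit into one chart. By connectedness it is enough to compare
    -- nearby points of `K`, in both directions.
    refine hKc.induction₂' (fun a b => Rel x a → Rel x b) (fun a ha => ?_)
      (fun a b c _ _ _ hab hbc h => hbc (hab h)) hy hz
    obtain ⟨i, hi, hai⟩ := hcov' a
    obtain ⟨φ, -, -, -, e⟩ := F.compatible t ht (s i) (hs i) a ⟨hK ha, (C i).dom_subset hai⟩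
    filter_upwards [self_mem_nhdsWithin, mem_nhdsWithin_of_mem_nhds e,
      mem_nhdsWithin_of_mem_nhds ((C i).isOpen_dom.mem_nhds hai)] with b hbK hb hbi
    have hab : (s i).map a = (s i).map b := by
      rw [e.self_of_nhds, show (s i).map b = _ from hb]
      exact congrArg φ ((hKt a ha).trans (hKt b hbK).symm)
    exact ⟨fun h => hstep x a b h i hi hai hbi hab,
      fun h => hstep x b a h i hi hbi hai hab.symm⟩
  have hgen : ∀ y z, Relation.EqvGen F.SamePlaque y z → ∀ x, (Rel x y ↔ Rel x z) := by
    intro y z h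
    induction h with
    | rel y z h => exact fun x => ⟨hplaque x y z h, hplaque x z y h.symm⟩
    | refl y => exact fun x => Iff.rfl
    | symm y z _ ih => exact fun x => (ih x).symm
    | trans y z w _ _ ih ih' => exact fun x => (ih x).trans (ih' x)
  refine ⟨⋃ N, S N, countable_iUnion hSc, fun x y hxy => ?_⟩
  obtain ⟨j, hj, hyj⟩ := hcov' y
  obtain ⟨N, g, hg, hxg, h⟩ := (hgen x y (Quotient.exact hxy) x).1 (hrefl x) j hj hyj
  exact ⟨g, mem_iUnion.2 ⟨N, hg⟩, (C j).toSlide (hs j), mem_iUnion.2 ⟨0, ⟨j, hj, rfl⟩⟩, hxg, hyj, h⟩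

/-! ### Independence of the lift, by Baire category -/

/-- The pullback of a basic form along a smooth map to `M` depends only on the projection of the
map to the leaf space. -/
theorem pull_eq_of_proj_eq [SecondCountableTopology M] {k m : ℕ} (θ : F.BasicForm k)
    {u : Set (E m)} (hu : IsOpen u) {p p' : E m → M} (hp : ContMDiffOn (𝓡 m) (𝓡 n) ∞ p u)
    (hp' : ContMDiffOn (𝓡 m) (𝓡 n) ∞ p' u) (h : ∀ y ∈ u, F.proj (p y) = F.proj (p' y)) {y : E m}
    (hy : y ∈ u) : pull m n p θ.1 y = pull m n p' θ.1 y := by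
  by_contra hne
  obtain ⟨S, hS, hSx⟩ := F.exists_countable_slides
  have hat : ∀ y ∈ u, ContMDiffAt (𝓡 m) (𝓡 n) ∞ p y := fun y hy => hp.contMDiffAt (hu.mem_nhds hy)
  have hat' : ∀ y ∈ u, ContMDiffAt (𝓡 m) (𝓡 n) ∞ p' y := fun y hy =>
    hp'.contMDiffAt (hu.mem_nhds hy)
  -- The open set where the two pullbacks differ. The sets `A a` cover it, and a nonempty open set
  -- is not meagre, so it is enough that each `A a` is nowhere dense.
  let N : Set (E m) := u ∩ (fun y => pull m n p θ.1 y - pull m n p' θ.1 y) ⁻¹' {0}ᶜ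
  have hcont : ContinuousOn (fun y => pull m n p θ.1 y - pull m n p' θ.1 y) u := fun y hy =>
    ((pull_smooth (F.basicToMForm k θ) (hat y hy)).continuousAt.sub
      (pull_smooth (F.basicToMForm k θ) (hat' y hy)).continuousAt).continuousWithinAt
  have hN : IsOpen N := hcont.isOpen_inter_preimage hu isOpen_compl_singleton
  have hNy : y ∈ N := ⟨hy, sub_ne_zero.2 hne⟩
  refine not_isMeagre_of_isOpen hN ⟨y, hNy⟩ ?_
  have hSS : Countable (S ×ˢ S : Set (F.Slide × F.Slide)) := (hS.prod hS).to_subtype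
  let A : F.Slide × F.Slide → Set (E m) := fun a =>
    {y ∈ N | p y ∈ a.1.dom ∧ p' y ∈ a.2.dom ∧ a.1.map (p y) = a.2.map (p' y)}
  have hcov : N ⊆ ⋃ a : (S ×ˢ S : Set (F.Slide × F.Slide)), A a := by
    intro z hz
    obtain ⟨g, hg, g', hg', h1, h2, h3⟩ := hSx _ _ (h z hz.1)
    exact mem_iUnion.2 ⟨⟨(g, g'), hg, hg'⟩, hz, h1, h2, h3⟩
  refine IsMeagre.mono hcov (isMeagre_iUnion fun a => IsNowhereDense.isMeagre ?_)
  obtain ⟨⟨g, g'⟩, -⟩ := a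
  show interior (closure (A (g, g'))) = ∅
  rw [← not_nonempty_iff_eq_empty]
  intro hint
  let O : Set (E m) := N ∩ (p ⁻¹' g.dom ∩ p' ⁻¹' g'.dom)
  have hO : IsOpen O := by
    have h1 := (hp.continuousOn.mono inter_subset_left).isOpen_inter_preimage hN g.isOpen_dom
    have h2 := (hp'.continuousOn.mono inter_subset_left).isOpen_inter_preimage hN g'.isOpen_dom
    have : O = (N ∩ p ⁻¹' g.dom) ∩ (N ∩ p' ⁻¹' g'.dom) := inter_inter_distrib_left _ _ _
    rw [this]
    exact h1.inter h2
  have hAO : A (g, g') ⊆ O := fun z hz => ⟨hz.1, hz.2.1, hz.2.2.1⟩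
  -- As `M` is Hausdorff, the coincidence set is closed relative to the open set `O` where both
  -- composites are defined.
  have hclosed : closure (A (g, g')) ∩ O ⊆ A (g, g') := by
    rintro z ⟨hz, hzO⟩
    refine ⟨hzO.1, hzO.2.1, hzO.2.2, ?_⟩
    have c1 : ContinuousAt (fun z => g.map (p z)) z :=
      ContinuousAt.comp (f := p) (g.contMDiffAt hzO.2.1).continuousAt (hat z hzO.1.1).continuousAt
    have c2 : ContinuousAt (fun z => g'.map (p' z)) z :=
      ContinuousAt.comp (f := p') (g'.contMDiffAt hzO.2.2).continuousAt
        (hat' z hzO.1.1).continuousAt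
    have := mem_closure_iff_nhdsWithin_neBot.1 hz
    refine tendsto_nhds_unique (l := 𝓝[A (g, g')] z) (c1.mono_left nhdsWithin_le_nhds)
      ((c2.mono_left nhdsWithin_le_nhds).congr' ?_)
    filter_upwards [self_mem_nhdsWithin] with w hw using hw.2.2.2.symm
  -- The closure has interior points, hence one in `A (g, g')` itself; near it the composites
  -- coincide, so the two pullbacks agree there, against the choice of `N`.
  obtain ⟨z, hz⟩ := hint
  obtain ⟨w, hw, hwA⟩ := mem_closure_iff.1 (interior_subset hz) _ isOpen_interior hz
  have hwO := hAO hwA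
  have hnear : ∀ᶠ t in 𝓝 w, t ∈ A (g, g') := by
    filter_upwards [isOpen_interior.mem_nhds hw, hO.mem_nhds hwO] with t ht htO
    exact hclosed ⟨interior_subset ht, htO⟩
  have e : g.map ∘ p =ᶠ[𝓝 w] g'.map ∘ p' := hnear.mono fun t ht => ht.2.2.2
  have h1 := g.pull_comp_eq θ (hat w hwA.1.1) hwA.2.1
  have h2 := g'.pull_comp_eq θ (hat' w hwA.1.1) hwA.2.2.1
  rw [pull_congr e] at h1
  exact hwA.1.2 (sub_eq_zero.2 (h1.symm.trans h2))

end Foliation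

/-! ### Diffeological forms on manifolds -/

/-- The restriction of a plot to an open set. -/
def LocalPlot.restrict {X : Type*} [DiffeologicalSpace X] {m : ℕ} (P : LocalPlot X m)
    {u : Set (E m)} (hu : IsOpen u) : LocalPlot X m where
  dom := P.dom ∩ u
  isOpen_dom := P.isOpen_dom.inter hu
  map := P.map
  isPlotOn := fun l f hf hfu => P.isPlotOn l f hf fun y => (hfu y).1

/-- Compatibility along the identity map; it makes forms local in the plot. -/
theorem DForm.eq_of_eqOn {X : Type*} [DiffeologicalSpace X] {k m : ℕ} (γ : DForm X k)
    {P Q : LocalPlot X m} (hd : Q.dom ⊆ P.dom) (h : ∀ y ∈ Q.dom, Q.map y = P.map y) {y : E m}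
    (hy : y ∈ Q.dom) : γ.1 m Q y = γ.1 m P y := by
  rw [γ.2.2.2 m m P Q id contDiffOn_id hd h y hy, fderiv_id]
  rfl

/-- A smooth map from an open set to a manifold, as a plot. -/
def smoothPlot {m : ℕ} {u : Set (E m)} (hu : IsOpen u) {p : E m → M}
    (hp : ContMDiffOn (𝓡 m) (𝓡 n) ∞ p u) : @LocalPlot M (manifoldDiffeology n M) m :=
  let _ := manifoldDiffeology n M
  ⟨u, hu, p, (isPlotOn_manifold_iff hu).2 hp⟩

theorem LocalPlot.contMDiffAt {m : ℕ} (P : @LocalPlot M (manifoldDiffeology n M) m) {y : E m}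
    (hy : y ∈ @LocalPlot.dom M (manifoldDiffeology n M) m P) :
    ContMDiffAt (𝓡 m) (𝓡 n) ∞ (@LocalPlot.map M (manifoldDiffeology n M) m P) y :=
  let _ := manifoldDiffeology n M
  ((isPlotOn_manifold_iff P.isOpen_dom).1 P.isPlotOn).contMDiffAt (P.isOpen_dom.mem_nhds hy)

theorem MForm.toDForm_apply {k m : ℕ} (η : MForm n M k)
    (P : @LocalPlot M (manifoldDiffeology n M) m) {y : E m}
    (hy : y ∈ @LocalPlot.dom M (manifoldDiffeology n M) m P) :
    (MForm.toDForm k η).1 m P y =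
      pull m n (@LocalPlot.map M (manifoldDiffeology n M) m P) η.1 y :=
  indicator_of_mem hy _

theorem MForm.toDForm_smoothPlot {k m : ℕ} (η : MForm n M k) {u : Set (E m)} (hu : IsOpen u)
    {p : E m → M} (hp : ContMDiffOn (𝓡 m) (𝓡 n) ∞ p u) {y : E m} (hy : y ∈ u) :
    (MForm.toDForm k η).1 m (smoothPlot hu hp) y = pull m n p η.1 y :=
  MForm.toDForm_apply η (smoothPlot hu hp) hy

theorem MForm.toDForm_injective (k : ℕ) :
    Function.Injective (MForm.toDForm (n := n) (M := M) k) := by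
  intro η θ h
  refine Subtype.ext (ext_rep fun c z hz => ?_)
  have hp := contMDiffOn_extChartAt_symm (I := 𝓡 n) (n := ∞) c
  have ho := isOpen_extChartAt_target (I := 𝓡 n) c
  exact (MForm.toDForm_smoothPlot η ho hp hz).symm.trans
    ((congrArg (fun ζ : ManifoldDForm n M k => ζ.1 n (smoothPlot ho hp) z) h).trans
      (MForm.toDForm_smoothPlot θ ho hp hz))

/-- The plot given by the inverse of the preferred chart at `c`. -/
def chartPlot (c : M) : @LocalPlot M (manifoldDiffeology n M) n :=
  smoothPlot (isOpen_extChartAt_target c) (contMDiffOn_extChartAt_symm c)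

/-- The form at `x` is read off from the plot inverse to the preferred chart at `x`. Near each point
a plot factors through such a chart, so compatibility recovers all values of `γ`. -/
theorem MForm.toDForm_surjective (k : ℕ) :
    Function.Surjective (MForm.toDForm (n := n) (M := M) k) := by
  let _ := manifoldDiffeology n M
  intro γ
  let η : RawForm n M k := fun x =>
    (γ.1 n (chartPlot x) (extChartAt (𝓡 n) x x)).compContinuousLinearMap
      (tmap n n (extChartAt (𝓡 n) x) x)
  have key : ∀ (m : ℕ) (P : LocalPlot M m), ∀ y ∈ P.dom,
      pull m n P.map η y = γ.1 m P y := by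
    intro m P y hy
    let φ := extChartAt (𝓡 n) (P.map y)
    have hP : ContMDiffOn (𝓡 m) (𝓡 n) ∞ P.map P.dom :=
      fun z hz => (LocalPlot.contMDiffAt P hz).contMDiffWithinAt
    have hu : IsOpen (P.dom ∩ P.map ⁻¹' φ.source) :=
      hP.continuousOn.isOpen_inter_preimage P.isOpen_dom (isOpen_extChartAt_source _)
    let Q : LocalPlot M m := P.restrict hu
    have hyφ : P.map y ∈ φ.source := mem_extChartAt_source _
    have hyQ : y ∈ Q.dom := ⟨hy, hy, hyφ⟩
    have hf : ContDiffOn ℝ ∞ (φ ∘ P.map) Q.dom := by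
      intro z hz
      exact ((chart_smooth (P.map y) hz.2.2).comp z
        (LocalPlot.contMDiffAt P hz.1)).contDiffAt.contDiffWithinAt
    have h1 := γ.2.2.2 m n (chartPlot (P.map y)) Q (φ ∘ P.map) hf
      (fun z hz => φ.map_source hz.2.2) (fun z hz => (φ.left_inv hz.2.2).symm) y hyQ
    have h2 : γ.1 m Q y = γ.1 m P y := DForm.eq_of_eqOn γ (P := P) (Q := Q) inter_subset_left
      (fun _ _ => rfl) hyQ
    have h3 : fderiv ℝ (φ ∘ P.map) y = (tmap n n φ (P.map y)).comp (tmap m n P.map y) := by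
      rw [← tmap_eucl]
      exact tmap_comp ((chart_smooth (P.map y) hyφ).mdifferentiableAt (by simp))
        ((LocalPlot.contMDiffAt P hy).mdifferentiableAt (by simp))
    rw [← h2, h1, h3]
    rfl
  refine ⟨⟨η, fun c => ?_⟩, ?_⟩
  -- The chart defining `η` changes from point to point, so smoothness is not visible in the
  -- definition; by `key`, `η` in the fixed chart at `c` is the smooth value of `γ` on `chartPlot
  -- c`.
  · exact (γ.2.1 n (chartPlot c)).congr fun z hz => key n (chartPlot c) z hz
  · refine DForm.ext_on fun m P y hy => ?_
    rw [MForm.toDForm_apply _ P hy]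
    exact key m P y hy

theorem MForm.toDForm_d {k : ℕ} (η : MForm n M k) :
    MForm.toDForm (k + 1) (MForm.d k η) =
      @DForm.d M (manifoldDiffeology n M) k (MForm.toDForm k η) := by
  let _ := manifoldDiffeology n M
  refine DForm.ext_on fun m P y hy => ?_
  rw [DForm.d_apply _ P hy, MForm.toDForm_apply _ P hy,
    extDeriv_congr_on P.isOpen_dom (fun z hz => MForm.toDForm_apply η P hz) y hy]
  exact pull_dRaw η (LocalPlot.contMDiffAt P hy)

theorem MForm.toDForm_pullback {k : ℕ} (g : M → M) (hg : ContMDiff (𝓡 n) (𝓡 n) ∞ g)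
    (hg' : @DSmooth M M (manifoldDiffeology n M) (manifoldDiffeology n M) g) (η : MForm n M k) :
    MForm.toDForm k (MForm.pullback g hg k η) =
      @DForm.pullback M M (manifoldDiffeology n M) (manifoldDiffeology n M) g hg' k
        (MForm.toDForm k η) := by
  let _ := manifoldDiffeology n M
  refine DForm.ext_on fun m P y hy => ?_
  rw [MForm.toDForm_apply _ P hy]
  refine Eq.trans ?_ (MForm.toDForm_apply η (P.post g hg') hy).symm
  exact (pull_comp (hg.mdifferentiableAt (by simp))
    ((LocalPlot.contMDiffAt P hy).mdifferentiableAt (by simp))).symm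

namespace Foliation

variable {F : Foliation n q M}

/-! ### Forms on the leaf space pull back to basic forms -/

/-- On `u` the maps `p` and `p'` induce one and the same plot of the leaf space. -/
theorem pull_eq_of_toDForm_eq {k m : ℕ} {α : DForm F.LeafSpace k} {η : MForm n M k}
    (h : MForm.toDForm k η = F.projPullback k α) {u : Set (E m)} (hu : IsOpen u)
    {p p' : E m → M} (hp : ContMDiffOn (𝓡 m) (𝓡 n) ∞ p u)
    (hp' : ContMDiffOn (𝓡 m) (𝓡 n) ∞ p' u) (hpp : ∀ y ∈ u, F.proj (p y) = F.proj (p' y))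
    {y : E m} (hy : y ∈ u) : pull m n p η.1 y = pull m n p' η.1 y := by
  let _ := manifoldDiffeology n M
  rw [← MForm.toDForm_smoothPlot η hu hp hy, ← MForm.toDForm_smoothPlot η hu hp' hy, h]
  exact DForm.eq_of_eqOn α (P := (smoothPlot hu hp').post F.proj F.dsmooth_proj)
    (Q := (smoothPlot hu hp).post F.proj F.dsmooth_proj) subset_rfl hpp hy

/-- A slide moves points within plaques, so it does not change the projection. Plots have Euclidean
domains, hence the detour through a chart at `x`. -/
theorem pull_slide_of_toDForm_eq {k : ℕ} {α : DForm F.LeafSpace k} {η : MForm n M k}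
    (h : MForm.toDForm k η = F.projPullback k α) {s : LocalSubmersion n q M} (hs : s ∈ F.family)
    (C : FlatChart s) {x : M} (hx : x ∈ C.dom) : pull n n C.slide η.1 x = η.1 x := by
  let φ := extChartAt (𝓡 n) x
  have hxs : x ∈ φ.source := mem_extChartAt_source x
  have hφx : φ.symm (φ x) = x := φ.left_inv hxs
  have hsymm := contMDiffOn_extChartAt_symm (I := 𝓡 n) (n := ∞) x
  have hu : IsOpen (φ.target ∩ φ.symm ⁻¹' C.dom) :=
    hsymm.continuousOn.isOpen_inter_preimage (isOpen_extChartAt_target x) C.isOpen_dom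
  have hy : φ x ∈ φ.target ∩ φ.symm ⁻¹' C.dom :=
    ⟨φ.map_source hxs, by rw [mem_preimage, hφx]; exact hx⟩
  have key := pull_eq_of_toDForm_eq h hu (p := C.slide ∘ φ.symm) (p' := φ.symm)
    (C.slide_smooth.comp (hsymm.mono inter_subset_left) fun z hz => hz.2)
    (hsymm.mono inter_subset_left)
    (fun z hz => Quotient.sound (.rel _ _
      (C.samePlaque hs (C.slide_mem hz.2) hz.2 (C.map_slide hz.2)))) hy
  have h1 : MDifferentiableAt (𝓡 n) (𝓡 n) φ x :=
    (chart_smooth x hxs).mdifferentiableAt (by simp)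
  have h2 : MDifferentiableAt (𝓡 n) (𝓡 n) φ.symm (φ x) :=
    (chart_symm_smooth x (φ.map_source hxs)).mdifferentiableAt (by simp)
  have h3 : MDifferentiableAt (𝓡 n) (𝓡 n) C.slide (φ.symm (φ x)) := by
    rw [hφx]
    exact (C.slide_smooth.contMDiffAt (C.isOpen_dom.mem_nhds hx)).mdifferentiableAt (by simp)
  have e : φ.symm ∘ φ =ᶠ[𝓝 x] id := by
    filter_upwards [(isOpen_extChartAt_source (I := 𝓡 n) x).mem_nhds hxs] with t ht
    exact φ.left_inv ht
  have e' : C.slide =ᶠ[𝓝 x] (C.slide ∘ φ.symm) ∘ φ := by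
    filter_upwards [e] with t ht
    exact congrArg C.slide ht.symm
  have hid : tmap n n (id : M → M) x = ContinuousLinearMap.id ℝ (E n) := mfderiv_id
  have e3 : pull n n φ (pull n n (C.slide ∘ φ.symm) η.1) x =
      pull n n φ (pull n n φ.symm η.1) x :=
    congrArg (fun ζ : Alt n k => ζ.compContinuousLinearMap (tmap n n φ x)) key
  rw [pull_congr e', pull_comp (m := n) (h3.comp _ h2) h1, e3, ← pull_comp (m := n) h2 h1,
    pull_congr e]
  simp only [pull, hid]
  rfl

/-- The form is its own pullback by a slide, and the slide factors through `s.map`, whose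
differential kills `X`. -/
theorem contraction_eq_zero_of_toDForm_eq {k : ℕ} {α : DForm F.LeafSpace k} {η : MForm n M k}
    (h : MForm.toDForm k η = F.projPullback k α) {X : M → E n} (hX : F.IsTangent X) :
    contraction X η.1 = 0 := by
  cases k with
  | zero => rfl
  | succ k =>
    funext x
    obtain ⟨s, hs, hxs⟩ := F.cover x
    obtain ⟨C, hxC, -⟩ := exists_flatChart s hxs isOpen_univ (mem_univ x)
    have hd : MDifferentiableAt (𝓡 q) (𝓡 n) C.slice (s.map x) :=
      (C.slice_smooth.contMDiffAt
        (C.isOpen_sliceDom.mem_nhds (C.map_mem_sliceDom hxC))).mdifferentiableAt (by simp)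
    have ht : tmap n n C.slide x = (tmap q n C.slice (s.map x)).comp (tmap n q s.map x) :=
      mfderiv_comp x hd (s.mdifferentiableAt hxs)
    have h0 : tmap n n C.slide x (X x) = 0 := by
      rw [ht]
      exact (congrArg (tmap q n C.slice (s.map x)) (hX s hs x hxs)).trans (map_zero _)
    have hη : η.1 x = (η.1 (C.slide x)).compContinuousLinearMap (tmap n n C.slide x) :=
      (pull_slide_of_toDForm_eq h hs C hxC).symm
    show (η.1 x).curryLeft (X x) = 0
    rw [hη, ContinuousAlternatingMap.curryLeft_compContinuousLinearMap, h0, map_zero]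
    rfl

/-- The differential of `η` comes from that of `α`, so the vanishing of contractions applies to
both. -/
theorem isBasic_of_toDForm_eq {k : ℕ} {α : DForm F.LeafSpace k} {η : MForm n M k}
    (h : MForm.toDForm k η = F.projPullback k α) : F.IsBasic η.1 := by
  refine (F.isBasic_iff η.1).2 fun X _ hX => ⟨contraction_eq_zero_of_toDForm_eq h hX, ?_⟩
  have hd : MForm.toDForm (k + 1) (MForm.d k η) = F.projPullback (k + 1) (DForm.d k α) := by
    rw [MForm.toDForm_d, h]
    rfl
  exact contraction_eq_zero_of_toDForm_eq hd hX

/-! ### Basic forms descend to the leaf space -/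

/-- The map `p` is a smooth lift to `M` of the plot `P` of the leaf space on the open set `u`. -/
structure IsLift {m : ℕ} (P : LocalPlot F.LeafSpace m) (u : Set (E m)) (p : E m → M) : Prop where
  isOpen : IsOpen u
  subset : u ⊆ P.dom
  smooth : ContMDiffOn (𝓡 m) (𝓡 n) ∞ p u
  map_eq : ∀ y ∈ u, P.map y = F.proj (p y)

/-- The quotient diffeology provides lifts of plots defined on all of `ℝᵐ`; a ball in `P.dom` is
parametrized by `ℝᵐ` through `f`, and `g` leads back. -/
theorem exists_lift {m : ℕ} (P : LocalPlot F.LeafSpace m) {y : E m} (hy : y ∈ P.dom) :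
    ∃ u p, IsLift P u p ∧ y ∈ u := by
  obtain ⟨f, g, v, hv, hyv, hvd, hf, hfv, hg, hfg⟩ := exists_param P.isOpen_dom hy
  obtain ⟨w, hw, hyw, p, hp, hPp⟩ := P.isPlotOn m f hf (fun z => hvd (hfv z)) (g y)
  have ho := hg.continuousOn.isOpen_inter_preimage hv hw
  refine ⟨v ∩ g ⁻¹' w, p ∘ g, ⟨ho, fun z hz => hvd hz.1, ?_, fun z hz => ?_⟩, hyv, hyw⟩
  · exact ((isPlotOn_manifold_iff hw).1 hp).comp (hg.mono inter_subset_left).contMDiffOn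
      fun z hz => hz.2
  · have h := hPp (g z) hz.2
    rwa [Function.comp_apply, hfg z hz.1] at h

theorem projPullback_injective (F : Foliation n q M) (k : ℕ) :
    Function.Injective (F.projPullback k) := by
  let _ := manifoldDiffeology n M
  intro α β h
  refine DForm.ext_on fun m P y hy => ?_
  obtain ⟨u, p, hp, hyu⟩ := exists_lift P hy
  let Q : LocalPlot M m := smoothPlot hp.isOpen hp.smooth
  have h1 : ∀ γ : DForm F.LeafSpace k, (F.projPullback k γ).1 m Q y = γ.1 m P y := fun γ =>
    DForm.eq_of_eqOn γ (Q := Q.post F.proj F.dsmooth_proj) hp.subset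
      (fun z hz => (hp.map_eq z hz).symm) hyu
  rw [← h1, ← h1, h]

open Classical in
/-- The value on plots of the form on the leaf space induced by a basic form. -/
def descendRaw {k : ℕ} (θ : F.BasicForm k) (m : ℕ) (P : LocalPlot F.LeafSpace m) (y : E m) :
    Alt m k :=
  if hy : y ∈ P.dom then pull m n (exists_lift P hy).choose_spec.choose θ.1 y else 0

variable [T2Space M] [SecondCountableTopology M]

/-- `descendRaw` picks a lift anew at every point. Since the lift does not matter, a single one
computes all values near a point, which gives smoothness and compatibility. -/
theorem descendRaw_eq {k m : ℕ} (θ : F.BasicForm k) {P : LocalPlot F.LeafSpace m}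
    {u : Set (E m)} {p : E m → M} (hp : IsLift P u p) {y : E m} (hy : y ∈ u) :
    descendRaw θ m P y = pull m n p θ.1 y := by
  have hyP := hp.subset hy
  have h := (exists_lift P hyP).choose_spec.choose_spec
  rw [descendRaw, dif_pos hyP]
  refine pull_eq_of_proj_eq θ (h.1.isOpen.inter hp.isOpen) (h.1.smooth.mono inter_subset_left)
    (hp.smooth.mono inter_subset_right) (fun z hz => ?_) ⟨h.2, hy⟩
  rw [← h.1.map_eq z hz.1, hp.map_eq z hz.2]

/-- The form on the leaf space induced by a basic form. -/
def descend {k : ℕ} (θ : F.BasicForm k) : DForm F.LeafSpace k :=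
  ⟨descendRaw θ, by
    refine ⟨fun m P y hy => ?_, fun m P y hy => dif_neg hy, ?_⟩
    · obtain ⟨u, p, hp, hyu⟩ := exists_lift P hy
      refine ContDiffAt.contDiffWithinAt (ContDiffAt.congr_of_eventuallyEq
        (pull_smooth (F.basicToMForm k θ) (hp.smooth.contMDiffAt (hp.isOpen.mem_nhds hyu))) ?_)
      filter_upwards [hp.isOpen.mem_nhds hyu] with z hz using descendRaw_eq θ hp hz
    · intro l m P Q f hf hm he y hy
      obtain ⟨u, p, hp, hyu⟩ := exists_lift P (hm hy)
      have ho : IsOpen (Q.dom ∩ f ⁻¹' u) :=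
        hf.continuousOn.isOpen_inter_preimage Q.isOpen_dom hp.isOpen
      have hpf : IsLift Q (Q.dom ∩ f ⁻¹' u) (p ∘ f) :=
        ⟨ho, inter_subset_left,
          hp.smooth.comp (hf.mono inter_subset_left).contMDiffOn fun z hz => hz.2,
          fun z hz => (he z hz.1).trans (hp.map_eq _ hz.2)⟩
      rw [descendRaw_eq θ hpf ⟨hy, hyu⟩, descendRaw_eq θ hp hyu, ← pull_eucl]
      exact pull_comp
        ((hp.smooth.contMDiffAt (hp.isOpen.mem_nhds hyu)).mdifferentiableAt (by simp))
        ((hf.contDiffAt (Q.isOpen_dom.mem_nhds hy)).differentiableAt (by simp)).mdifferentiableAt⟩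

/-- A plot of `M` is a lift of its own projection. -/
theorem projPullback_descend {k : ℕ} (θ : F.BasicForm k) :
    F.projPullback k (descend θ) = MForm.toDForm k (F.basicToMForm k θ) := by
  let _ := manifoldDiffeology n M
  refine DForm.ext_on fun m P y hy => ?_
  rw [MForm.toDForm_apply _ P hy]
  exact descendRaw_eq θ (P := P.post F.proj F.dsmooth_proj) (u := P.dom) (p := P.map)
    ⟨P.isOpen_dom, subset_rfl, fun z hz => (LocalPlot.contMDiffAt P hz).contMDiffWithinAt,
      fun _ _ => rfl⟩ hy

/-! ### The isomorphism of complexes -/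

/-- Basic forms as diffeological forms on the manifold. -/
def basicToDForm (F : Foliation n q M) (k : ℕ) : F.BasicForm k →ₗ[ℝ] ManifoldDForm n M k :=
  MForm.toDForm k ∘ₗ F.basicToMForm k

theorem basicToDForm_injective (F : Foliation n q M) (k : ℕ) :
    Function.Injective (F.basicToDForm k) :=
  (MForm.toDForm_injective k).comp (Submodule.inclusion_injective _)

/-- Both complexes embed into the diffeological forms of `M`; equal images give the isomorphism, and
identities between basic forms can be checked there. -/
theorem range_projPullback (F : Foliation n q M) (k : ℕ) :
    LinearMap.range (F.projPullback k) = LinearMap.range (F.basicToDForm k) := by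
  apply le_antisymm
  · rintro _ ⟨α, rfl⟩
    obtain ⟨η, hη⟩ := MForm.toDForm_surjective k (F.projPullback k α)
    exact ⟨⟨η.1, η.2, isBasic_of_toDForm_eq hη⟩, hη⟩
  · rintro _ ⟨θ, rfl⟩
    exact ⟨descend θ, projPullback_descend θ⟩

/-- Pullback to `M`, as an isomorphism from the forms on the leaf space to the basic forms. -/
def formEquiv (F : Foliation n q M) (k : ℕ) : DForm F.LeafSpace k ≃ₗ[ℝ] F.BasicForm k :=
  LinearEquiv.ofInjective _ (F.projPullback_injective k) ≪≫ₗ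
    LinearEquiv.ofEq _ _ (F.range_projPullback k) ≪≫ₗ
    (LinearEquiv.ofInjective _ (F.basicToDForm_injective k)).symm

theorem basicToDForm_formEquiv (F : Foliation n q M) (k : ℕ) (α : DForm F.LeafSpace k) :
    F.basicToDForm k (F.formEquiv k α) = F.projPullback k α :=
  congrArg Subtype.val ((LinearEquiv.ofInjective _ (F.basicToDForm_injective k)).apply_symm_apply
    (LinearEquiv.ofEq _ _ (F.range_projPullback k)
      (LinearEquiv.ofInjective _ (F.projPullback_injective k) α)))

theorem formEquiv_d (F : Foliation n q M) {k : ℕ} (α : DForm F.LeafSpace k) :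
    F.basicD k (F.formEquiv k α) = F.formEquiv (k + 1) (DForm.d k α) := by
  apply F.basicToDForm_injective
  rw [basicToDForm_formEquiv]
  refine (MForm.toDForm_d (F.basicToMForm k (F.formEquiv k α))).trans ?_
  exact congrArg (@DForm.d M (manifoldDiffeology n M) k) (F.basicToDForm_formEquiv k α)

/-- Pullback to `M`, as an isomorphism of complexes. -/
def complexIso (F : Foliation n q M) : dComplex F.LeafSpace ≅ F.basicComplex :=
  HomologicalComplex.Hom.isoOfComponents (fun k => (F.formEquiv k).toModuleIso) <| by
    rintro i _ rfl
    simp only [dComplex, basicComplex, CochainComplex.of_d]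
    ext α : 2
    exact F.formEquiv_d α

end Foliation

/-! ### The action on the leaf space -/

namespace Foliation

variable {F : Foliation n q M}

/-- The image of a plaque of `s` is a plaque of `s.map ∘ g'`, which belongs to the family because
`g'` is an automorphism. -/
theorem SamePlaque.map {g g' : M → M} (hg : F.IsAutomorphism g) (hg' : F.IsAutomorphism g')
    (h : Function.LeftInverse g' g) {x y : M} (hxy : F.SamePlaque x y) :
    F.SamePlaque (g x) (g y) := by
  obtain ⟨s, hs, K, hK, hKc, hx, hy, hsK⟩ := hxy
  obtain ⟨t, ht, htd, hts⟩ := hg'.preserves s hs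
  have hsub : g '' K ⊆ t.dom := by
    rintro _ ⟨z, hz, rfl⟩
    rw [htd, mem_preimage, h z]
    exact hK hz
  refine ⟨t, ht, g '' K, hsub, hKc.image g hg.contMDiff.continuous.continuousOn,
    mem_image_of_mem g hx, mem_image_of_mem g hy, ?_⟩
  rintro _ ⟨z, hz, rfl⟩
  rw [hts _ (hsub (mem_image_of_mem g hz)), hts _ (hsub (mem_image_of_mem g hx)), h z, h x]
  exact hsK z hz

/-- The map of leaf spaces induced by a foliation automorphism. -/
def leafMap {g g' : M → M} (hg : F.IsAutomorphism g) (hg' : F.IsAutomorphism g')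
    (h : Function.LeftInverse g' g) : F.LeafSpace → F.LeafSpace :=
  Quotient.map g fun x y hxy => by
    induction hxy with
    | rel x y hxy => exact .rel _ _ (hxy.map hg hg' h)
    | refl x => exact .refl _
    | symm x y _ ih => exact ih.symm
    | trans x y z _ _ ih ih' => exact ih.trans _ _ _ ih'

theorem dsmooth_leafMap {g g' : M → M} (hg : F.IsAutomorphism g) (hg' : F.IsAutomorphism g')
    (h : Function.LeftInverse g' g) : DSmooth (leafMap hg hg' h) := by
  intro m p hp x
  obtain ⟨u, hu, hxu, r, hr, hpr⟩ := hp x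
  exact ⟨u, hu, hxu, g ∘ r, fun l f hf hfu => hg.contMDiff.comp (hr l f hf hfu),
    fun y hy => congrArg (leafMap hg hg' h) (hpr y hy)⟩

variable {H : Type*} [Group H] [MulAction H M]

/-- The action on the leaf space of a group of foliation automorphisms. -/
@[reducible]
def leafAction (hH : ∀ h : H, F.IsAutomorphism fun x : M => h • x) : MulAction H F.LeafSpace where
  smul h := leafMap (hH h) (hH h⁻¹) fun x => inv_smul_smul h x
  one_smul := by
    rintro ⟨x⟩
    exact congrArg F.proj (one_smul H x)
  mul_smul g h := by
    rintro ⟨x⟩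
    exact congrArg F.proj (mul_smul g h x)

variable [T2Space M] [SecondCountableTopology M]

/-- For a plot `P` of `M`, the plots `f ∘ π ∘ P` and `π ∘ g ∘ P` of the leaf space agree. -/
theorem formEquiv_pullback {g : M → M} (hg : F.IsAutomorphism g) {f : F.LeafSpace → F.LeafSpace}
    (hf : DSmooth f) (hfg : ∀ x, f (F.proj x) = F.proj (g x)) {k : ℕ} (α : DForm F.LeafSpace k) :
    F.formEquiv k (DForm.pullback f hf k α) = F.basicPull hg k (F.formEquiv k α) := by
  let _ := manifoldDiffeology n M
  have hgs : DSmooth g := fun m p hp => hg.contMDiff.comp hp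
  apply F.basicToDForm_injective
  rw [basicToDForm_formEquiv]
  refine Eq.trans ?_ (MForm.toDForm_pullback g hg.contMDiff hgs
    (F.basicToMForm k (F.formEquiv k α))).symm
  rw [show MForm.toDForm k (F.basicToMForm k (F.formEquiv k α)) = F.projPullback k α from
    F.basicToDForm_formEquiv k α]
  refine DForm.ext_on fun m P y hy => ?_
  exact DForm.eq_of_eqOn α
    (P := (P.post g hgs).post F.proj F.dsmooth_proj)
    (Q := (P.post F.proj F.dsmooth_proj).post f hf) subset_rfl (fun z _ => hfg (P.map z)) hy

theorem dPullback_complexIso {g : M → M} (hg : F.IsAutomorphism g)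
    {f : F.LeafSpace → F.LeafSpace} (hf : DSmooth f) (hfg : ∀ x, f (F.proj x) = F.proj (g x)) :
    dPullback f hf ≫ F.complexIso.hom = F.complexIso.hom ≫ F.basicPullback hg := by
  ext k α : 3
  exact formEquiv_pullback hg hf hfg α

end Foliation

end LeafDeRham

end

theorem theorem2 {n q : ℕ} {M : Type u} [TopologicalSpace M] [T2Space M]
    [SecondCountableTopology M] [ChartedSpace (E n) M] [IsManifold (𝓡 n) ∞ M]
    (F : Foliation n q M) {H : Type*} [Group H] [MulAction H M]
    (hH : ∀ h : H, F.IsAutomorphism fun x : M => h • x) :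
    ∃ (act : MulAction H F.LeafSpace) (hact : ∀ h : H, IsDDiffeo fun y : F.LeafSpace => h • y),
      (∀ (h : H) (x : M), h • F.proj x = F.proj (h • x)) ∧
      ∃ Φ : dComplex F.LeafSpace ≅ F.basicComplex,
        (∀ (k : ℕ) (α : DForm F.LeafSpace k),
          MForm.toDForm k (F.basicToMForm k (Φ.hom.f k α)) = F.projPullback k α) ∧
        (∀ h : H, dPullback (fun y : F.LeafSpace => h • y) (hact h).1 ≫ Φ.hom =
          Φ.hom ≫ F.basicPullback (hH h)) ∧
        ∃ Ψ : ∀ k : ℕ, (dComplex F.LeafSpace).homology k ≅ F.basicComplex.homology k,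
          ∀ k : ℕ, (Ψ k).hom = HomologicalComplex.homologyMap Φ.hom k ∧
            ∀ h : H,
              HomologicalComplex.homologyMap
                (dPullback (fun y : F.LeafSpace => h • y) (hact h).1) k ≫ (Ψ k).hom =
              (Ψ k).hom ≫ HomologicalComplex.homologyMap (F.basicPullback (hH h)) k := by
  let act := Foliation.leafAction hH
  have hsm : ∀ h : H, Diffeology.DSmooth fun y : F.LeafSpace => h • y := fun h =>
    Foliation.dsmooth_leafMap (hH h) (hH h⁻¹) fun x => inv_smul_smul h x
  have hΦ : ∀ h : H, dPullback (fun y : F.LeafSpace => h • y) (hsm h) ≫ F.complexIso.hom =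
      F.complexIso.hom ≫ F.basicPullback (hH h) := fun h =>
    Foliation.dPullback_complexIso (hH h) (hsm h) fun _ => rfl
  refine ⟨act, fun h => ⟨hsm h, fun y => h⁻¹ • y, inv_smul_smul h, smul_inv_smul h, hsm h⁻¹⟩,
    fun _ _ => rfl, F.complexIso, F.basicToDForm_formEquiv, hΦ,
    fun k => HomologicalComplex.homologyMapIso F.complexIso k, fun k => ⟨rfl, fun h => ?_⟩⟩
  rw [HomologicalComplex.homologyMapIso_hom, ← HomologicalComplex.homologyMap_comp,
    ← HomologicalComplex.homologyMap_comp, hΦ h]
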